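/- A \emph{graph class} is a nonempty, isomorphism-closed collection of finite simple graphs (where nonemptiness means that it contains a graph with at least one vertex); it is \emph{hereditary} if $G \in \mathcal{P}$ implies $G[U] \in \mathcal{P}$ for every nonempty $U \subseteq V(G)$. The \emph{maximal connected induced $\mathcal{P}$ subgraphs problem} asks, given a finite simple graph $G$ on $n$ vertices, to output exactly once each of the $N$ inclusion-maximal elements (the \emph{solutions}) of the family of all nonempty $U \subseteq V(G)$ such that $G[U]$ is connected and $G[U] \in \mathcal{P}$. An algorithm is a deterministic program of the WHILE language on binary trees with unit-cost elementary steps (a machine model polynomial-time equivalent to Turing machines), extended by an output instruction; the input is the adjacency matrix of $G$, and vertex sets are output as characteristic vectors. The problem \emph{can be solved in polynomial total time} if there are an algorithm and a polynomial $p$ such that on every input the algorithm outputs all solutions and halts within $p(n, N)$ steps. It \emph{can be solved in incremental polynomial time} if there are an algorithm and a polynomial $p$ such that on every input the algorithm outputs all solutions and halts, and, for every $1 \le s \le N$, the $s$-th solution is output within the first $p(n, s)$ steps. \textbf{Theorem.} For every hereditary graph class $\mathcal{P}$, the maximal connected induced $\mathcal{P}$ subgraphs problem can be solved in polynomial total time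 if and only if it can be solved in incremental polynomial time. -/

import Mathlib

/-! ### Graph classes and maximal connected induced subgraphs -/

/-- A graph class: a nonempty collection of finite simple graphs, closed under isomorphism.
Graphs of the class are looked for among those with at least one vertex; whether the graph
without vertices belongs to the class is irrelevant. -/
structure GraphClass where
  Mem : ∀ {V : Type} [Finite V], SimpleGraph V → Prop
  iso_closed : ∀ {V W : Type} [Finite V] [Finite W] {G : SimpleGraph V} {H : SimpleGraph W},
    Nonempty (G ≃g H) → Mem G → Mem H
  nonempty : ∃ (n : ℕ) (G : SimpleGraph (Fin n)), 0 < n ∧ Mem G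

/-- A graph class is hereditary if `G[U]` is in the class whenever `G` is and `U` is a nonempty
set of vertices of `G`. -/
def GraphClass.Hereditary (P : GraphClass) : Prop :=
  ∀ {V : Type} [Finite V] (G : SimpleGraph V), P.Mem G →
    ∀ U : Set V, U.Nonempty → P.Mem (G.induce U)

/-- `U` is a connected `P` set of `G`: `G[U]` is connected (so `U` is nonempty) and in `P`. -/
def IsConnectedPSet (P : GraphClass) {n : ℕ} (G : SimpleGraph (Fin n))
    (U : Finset (Fin n)) : Prop :=
  (G.induce (U : Set (Fin n))).Connected ∧ P.Mem (G.induce (U : Set (Fin n)))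

/-- The solutions on input `G`: the inclusion-maximal connected `P` sets of `G`. -/
def maxConnectedPSets (P : GraphClass) {n : ℕ} (G : SimpleGraph (Fin n)) :
    Set (Finset (Fin n)) :=
  {U | Maximal (IsConnectedPSet P G) U}

/-! ### Machine model: WHILE programs over binary trees, with unit-cost steps

This is the classical WHILE language on tree-structured data (nil, cons, head, tail, test for
nil), which is polynomial-time equivalent to multitape Turing machines; an output instruction
is added so that a program can enumerate. -/

/-- The data of the programs: binary trees. -/
inductive BTree : Type
  | nil : BTree
  | cons : BTree → BTree → BTree

namespace BTree

/-- Left subtree (`nil` for `nil`). -/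
def hd : BTree → BTree
  | nil => nil
  | cons a _ => a

/-- Right subtree (`nil` for `nil`). -/
def tl : BTree → BTree
  | nil => nil
  | cons _ b => b

/-- A list of trees as a tree. -/
def ofList : List BTree → BTree
  | [] => nil
  | a :: l => cons a (ofList l)

open Classical in
/-- A truth value as a tree. -/
noncomputable def bit (p : Prop) : BTree := if p then cons nil nil else nil

end BTree

/-- Programs. Variables are numbered by `ℕ`; a program mentions only finitely many. -/
inductive Prog : Type
  /-- `x := nil` -/
  | setNil (x : ℕ) : Prog
  /-- `x := y` -/
  | copy (x y : ℕ) : Prog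
  /-- `x := cons y z` -/
  | cons (x y z : ℕ) : Prog
  /-- `x := hd y` -/
  | hd (x y : ℕ) : Prog
  /-- `x := tl y` -/
  | tl (x y : ℕ) : Prog
  /-- output the value of `x` -/
  | emit (x : ℕ) : Prog
  /-- `c; d` -/
  | seq (c d : Prog) : Prog
  /-- `if x ≠ nil then c else d` -/
  | ite (x : ℕ) (c d : Prog) : Prog
  /-- `while x ≠ nil do c` -/
  | while (x : ℕ) (c : Prog) : Prog

/-- A store assigns a tree to every variable. -/
abbrev Store : Type := ℕ → BTree

/-- The record of a computation, in chronological order, with exactly one entry per step: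
`none` for a step without output and `some v` for a step that outputs `v`. Its length is the
number of steps of the computation. -/
abbrev Trace : Type := List (Option BTree)

/-- `Exec c σ t τ`: program `c`, started in store `σ`, halts in store `τ`, and its computation
has trace `t`. Every assignment, every output, and every evaluation of a test of an `if` or a
`while` is one step. -/
inductive Exec : Prog → Store → Trace → Store → Prop
  | setNil (x : ℕ) (σ : Store) :
      Exec (.setNil x) σ [none] (Function.update σ x .nil)
  | copy (x y : ℕ) (σ : Store) :
      Exec (.copy x y) σ [none] (Function.update σ x (σ y))
  | cons (x y z : ℕ) (σ : Store) :
      Exec (.cons x y z) σ [none] (Function.update σ x (.cons (σ y) (σ z)))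
  | hd (x y : ℕ) (σ : Store) :
      Exec (.hd x y) σ [none] (Function.update σ x (σ y).hd)
  | tl (x y : ℕ) (σ : Store) :
      Exec (.tl x y) σ [none] (Function.update σ x (σ y).tl)
  | emit (x : ℕ) (σ : Store) :
      Exec (.emit x) σ [some (σ x)] σ
  | seq {c d : Prog} {σ₁ σ₂ σ₃ : Store} {t u : Trace} :
      Exec c σ₁ t σ₂ → Exec d σ₂ u σ₃ → Exec (.seq c d) σ₁ (t ++ u) σ₃
  | iteTrue {x : ℕ} {c d : Prog} {σ₁ σ₂ : Store} {t : Trace} :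
      σ₁ x ≠ .nil → Exec c σ₁ t σ₂ → Exec (.ite x c d) σ₁ (none :: t) σ₂
  | iteFalse {x : ℕ} {c d : Prog} {σ₁ σ₂ : Store} {t : Trace} :
      σ₁ x = .nil → Exec d σ₁ t σ₂ → Exec (.ite x c d) σ₁ (none :: t) σ₂
  | whileTrue {x : ℕ} {c : Prog} {σ₁ σ₂ σ₃ : Store} {t u : Trace} :
      σ₁ x ≠ .nil → Exec c σ₁ t σ₂ → Exec (.while x c) σ₂ u σ₃ →
      Exec (.while x c) σ₁ (none :: (t ++ u)) σ₃
  | whileFalse {x : ℕ} {c : Prog} {σ : Store} :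
      σ x = .nil → Exec (.while x c) σ [none] σ

/-- The language is deterministic: a program has at most one computation from a given store. -/
theorem Exec.unique {c : Prog} {σ τ τ' : Store} {t t' : Trace}
    (h : Exec c σ t τ) (h' : Exec c σ t' τ') : t = t' ∧ τ = τ' := by
  induction h generalizing t' τ' with
  | setNil x σ => cases h'; exact ⟨rfl, rfl⟩
  | copy x y σ => cases h'; exact ⟨rfl, rfl⟩
  | cons x y z σ => cases h'; exact ⟨rfl, rfl⟩
  | hd x y σ => cases h'; exact ⟨rfl, rfl⟩
  | tl x y σ => cases h'; exact ⟨rfl, rfl⟩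
  | emit x σ => cases h'; exact ⟨rfl, rfl⟩
  | seq _ _ ih₁ ih₂ =>
    cases h' with
    | seq a b =>
      obtain ⟨rfl, rfl⟩ := ih₁ a
      obtain ⟨rfl, rfl⟩ := ih₂ b
      exact ⟨rfl, rfl⟩
  | iteTrue hx _ ih =>
    cases h' with
    | iteTrue _ a => obtain ⟨rfl, rfl⟩ := ih a; exact ⟨rfl, rfl⟩
    | iteFalse hx' _ => exact absurd hx' hx
  | iteFalse hx _ ih =>
    cases h' with
    | iteTrue hx' _ => exact absurd hx hx'
    | iteFalse _ a => obtain ⟨rfl, rfl⟩ := ih a; exact ⟨rfl, rfl⟩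
  | whileTrue hx _ _ ih₁ ih₂ =>
    cases h' with
    | whileTrue _ a b =>
      obtain ⟨rfl, rfl⟩ := ih₁ a
      obtain ⟨rfl, rfl⟩ := ih₂ b
      exact ⟨rfl, rfl⟩
    | whileFalse hx' => exact absurd hx' hx
  | whileFalse hx =>
    cases h' with
    | whileTrue hx' _ _ => exact absurd hx hx'
    | whileFalse _ => exact ⟨rfl, rfl⟩

/-! ### Enumeration problems and their complexity -/

/-- The input graph as a tree: its adjacency matrix, a list of `n` rows of `n` bits. -/
noncomputable def encodeGraph {n : ℕ} (G : SimpleGraph (Fin n)) : BTree :=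
  BTree.ofList (List.ofFn fun i : Fin n =>
    BTree.ofList (List.ofFn fun j : Fin n => BTree.bit (G.Adj i j)))

/-- A vertex set as a tree: its characteristic vector, a list of `n` bits. -/
noncomputable def encodeVertexSet {n : ℕ} (U : Finset (Fin n)) : BTree :=
  BTree.ofList (List.ofFn fun i : Fin n => BTree.bit (i ∈ U))

/-- The initial store: variable `0` holds the input, all others hold `nil`. -/
def initStore (v : BTree) : Store := fun x => if x = 0 then v else .nil

/-- The values output during a computation, in the order in which they are output. -/
def Trace.outputs (t : Trace) : List BTree := t.reduceOption

/-- `c`, run on the graph `G`, halts with trace `t`, having output every maximal connected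
`P` set of `G` exactly once and nothing else. -/
def EnumeratesOn (P : GraphClass) (c : Prog) {n : ℕ} (G : SimpleGraph (Fin n))
    (t : Trace) : Prop :=
  (∃ τ : Store, Exec c (initStore (encodeGraph G)) t τ) ∧
  t.outputs.Nodup ∧
  ∀ v : BTree, v ∈ t.outputs ↔ ∃ U ∈ maxConnectedPSets P G, encodeVertexSet U = v

/-- The maximal connected induced `P` subgraphs problem can be solved in polynomial total time:
on every graph with `n` vertices and `N` solutions, some fixed program enumerates the solutions
and halts after at most `p(n, N)` steps, for some fixed polynomial `p`. -/
def SolvableInPolyTotalTime (P : GraphClass) : Prop :=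
  ∃ (c : Prog) (p : MvPolynomial (Fin 2) ℕ),
    ∀ (n : ℕ) (G : SimpleGraph (Fin n)), ∃ t : Trace, EnumeratesOn P c G t ∧
      t.length ≤ MvPolynomial.eval ![n, (maxConnectedPSets P G).ncard] p

/-- The maximal connected induced `P` subgraphs problem can be solved in incremental polynomial
time: on every graph with `n` vertices and `N` solutions, some fixed program enumerates the
solutions, and for `1 ≤ s ≤ N` its first `p(n, s)` steps include the output of the `s`-th
solution, for some fixed polynomial `p`. -/
def SolvableInIncrementalPolyTime (P : GraphClass) : Prop :=
  ∃ (c : Prog) (p : MvPolynomial (Fin 2) ℕ),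
    ∀ (n : ℕ) (G : SimpleGraph (Fin n)), ∃ t : Trace, EnumeratesOn P c G t ∧
      ∀ s : ℕ, 1 ≤ s → s ≤ (maxConnectedPSets P G).ncard →
        s ≤ (Trace.outputs (t.take (MvPolynomial.eval ![n, s] p))).length

/-! ### Polynomially bounded functions -/

/-! Incremental to total. The incremental bound does not limit the time between the last output and
the halt, so the program is rerun with a clock of at least `p(n, s + 1)` steps for `s = 0, 1, …`.
While `s < N` such a run outputs more than `s` solutions; for `s = N` it outputs exactly all of
them, which is recognised by there being no output beyond the first `s`. The collected list is then
emitted.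

Total to incremental. Let `L` consist of `∅` and the solutions known so far, let `U ∈ L`, let `v` be
a vertex and `K ⊆ U ∪ {v}`. Call a connected `P` set uncovered if no member of `L` contains it. If
`K` contains no uncovered set, then `G[K]` has at most `|L| + n` solutions
(`ncard_maxConnectedPSets_restrict_le`). The reason is that two distinct solutions of `G[K]` inside
a common connected `P` set are disjoint: otherwise their union would be connected, and in `P` by
heredity. So different solutions through `v` are covered by different members of `L`, while those
avoiding `v` lie in `U` and are pairwise disjoint. Hence the given program, run on `G[K]` with a
clock polynomial in `n` and `|L|`, decides whether `K` contains an uncovered set: a timeout itself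
means yes (`Enumerator.uncovers_iff`).

If the answer is yes for some `U ∪ {v}`, vertices are erased greedily until an uncovered connected
`P` set remains, and this is extended to a solution, necessarily a new one. If it is no for all `U`
and `v`, then `L` is complete (`mem_of_forall_not_hasUncovered`): a missing solution could be built
up vertex by vertex through connected sets, each covered by `L`.

The rest is programming in the WHILE language: polynomial-time combinators (`PolyTime`), a clocked
simulator (`Exec.clocked`), and a loop that outputs each value before it computes the next
(`PolyTime.exists_enumeration`). -/

/-- `f` is bounded by a polynomial in `m`. -/
def PolyBdd {α : Type} (m f : α → ℕ) : Prop := ∃ d : ℕ, ∀ a, f a ≤ (m a + 2) ^ d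

namespace PolyBdd

variable {α β : Type} {m f g : α → ℕ}

theorem mono (hf : PolyBdd m f) (h : ∀ a, g a ≤ f a) : PolyBdd m g :=
  let ⟨d, hd⟩ := hf
  ⟨d, fun a => (h a).trans (hd a)⟩

theorem self (m : α → ℕ) : PolyBdd m m := ⟨1, fun a => by simp⟩

/-- The summand `2` in `PolyBdd` keeps the base at least `2`: constants are absorbed by `k < 2 ^ k`,
and a sum of two bounds by one more factor. -/
theorem const (m : α → ℕ) (k : ℕ) : PolyBdd m fun _ => k :=
  ⟨k, fun a => (Nat.lt_two_pow_self).le.trans (Nat.pow_le_pow_left (by omega) k)⟩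

theorem add (hf : PolyBdd m f) (hg : PolyBdd m g) : PolyBdd m fun a => f a + g a := by
  obtain ⟨d, hd⟩ := hf
  obtain ⟨e, he⟩ := hg
  refine ⟨d + e + 1, fun a => ?_⟩
  have h1 : (m a + 2) ^ d ≤ (m a + 2) ^ (d + e) := Nat.pow_le_pow_right (by omega) (by omega)
  have h2 : (m a + 2) ^ e ≤ (m a + 2) ^ (d + e) := Nat.pow_le_pow_right (by omega) (by omega)
  have h3 := Nat.zero_le (m a * (m a + 2) ^ (d + e))
  rw [pow_succ]
  linarith [hd a, he a]

theorem mul (hf : PolyBdd m f) (hg : PolyBdd m g) : PolyBdd m fun a => f a * g a := by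
  obtain ⟨d, hd⟩ := hf
  obtain ⟨e, he⟩ := hg
  exact ⟨d + e, fun a => by rw [pow_add]; exact Nat.mul_le_mul (hd a) (he a)⟩

theorem pow (hf : PolyBdd m f) (k : ℕ) : PolyBdd m fun a => f a ^ k := by
  obtain ⟨d, hd⟩ := hf
  exact ⟨d * k, fun a => by rw [pow_mul]; exact Nat.pow_le_pow_left (hd a) k⟩

theorem trans {m' : α → ℕ} (hf : PolyBdd m f) (hm : PolyBdd m' m) : PolyBdd m' f := by
  obtain ⟨d, hd⟩ := hf
  exact ((hm.add (const m' 2)).pow d).mono hd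

theorem reindex (φ : β → α) (hf : PolyBdd m f) :
    PolyBdd (fun b => m (φ b)) (fun b => f (φ b)) :=
  let ⟨d, hd⟩ := hf
  ⟨d, fun b => hd (φ b)⟩

end PolyBdd

/-- A polynomial in two variables is bounded by a power of the sum of the variables plus two. -/
theorem MvPolynomial.exists_eval_lt_pow (p : MvPolynomial (Fin 2) ℕ) :
    ∃ d : ℕ, ∀ n s : ℕ, MvPolynomial.eval ![n, s] p < (n + s + 2) ^ d := by
  have key : PolyBdd (fun a : ℕ × ℕ => a.1 + a.2)
      (fun a => MvPolynomial.eval ![a.1, a.2] p) := by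
    induction p using MvPolynomial.induction_on with
    | C k => simpa using PolyBdd.const _ k
    | add p q hp hq => simpa using hp.add hq
    | mul_X p i hp =>
      have hi : PolyBdd (fun a : ℕ × ℕ => a.1 + a.2) (fun a => ![a.1, a.2] i) := by
        refine (PolyBdd.self _).mono fun a => ?_
        fin_cases i <;> simp
      simpa using hp.mul hi
  -- The extra `1` makes the bound strict: a run that halts in time leaves at least one tick on the
  -- clock.
  obtain ⟨d, hd⟩ := key.add (PolyBdd.const _ 1)
  exact ⟨d, fun n s => hd (n, s)⟩

/-! ### Trees and traces -/

namespace BTree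

@[simp] theorem hd_nil : hd nil = nil := rfl
@[simp] theorem tl_nil : tl nil = nil := rfl
@[simp] theorem hd_cons (a b : BTree) : hd (cons a b) = a := rfl
@[simp] theorem tl_cons (a b : BTree) : tl (cons a b) = b := rfl
@[simp] theorem ofList_nil : ofList [] = nil := rfl
@[simp] theorem ofList_cons (a : BTree) (l : List BTree) :
    ofList (a :: l) = cons a (ofList l) := rfl

@[simp] theorem bit_true : bit True = cons nil nil := by simp [bit]
@[simp] theorem bit_false : bit False = nil := by simp [bit]

@[simp] theorem bit_eq_nil {p : Prop} : bit p = nil ↔ ¬ p := by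
  by_cases h : p <;> simp [bit, h]

theorem bit_inj {p q : Prop} : bit p = bit q ↔ (p ↔ q) := by
  by_cases h : p <;> by_cases h' : q <;> simp [h, h']

theorem bit_congr {p q : Prop} (h : p ↔ q) : bit p = bit q := bit_inj.2 h

@[simp] theorem ofList_eq_nil {l : List BTree} : ofList l = nil ↔ l = [] := by
  cases l <;> simp

theorem ofList_injective : Function.Injective ofList := by
  intro l
  induction l with
  | nil => intro l' h; cases l' with
    | nil => rfl
    | cons => simp at h
  | cons a l ih => intro l' h; cases l' with
    | nil => simp at h
    | cons b l' =>
      simp only [ofList_cons, cons.injEq] at h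
      rw [h.1, ih h.2]

/-- The number `k` in unary. -/
def unary (k : ℕ) : BTree := ofList (List.replicate k nil)

@[simp] theorem unary_zero : unary 0 = nil := rfl
@[simp] theorem unary_eq_nil {k : ℕ} : unary k = nil ↔ k = 0 := by simp [unary]

end BTree

namespace Trace

@[simp] theorem outputs_nil : Trace.outputs [] = [] := rfl
@[simp] theorem outputs_cons_none (t : Trace) : Trace.outputs (none :: t) = Trace.outputs t := by
  simp [Trace.outputs]
@[simp] theorem outputs_cons_some (v : BTree) (t : Trace) :
    Trace.outputs (some v :: t) = v :: Trace.outputs t := by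
  simp [Trace.outputs]
@[simp] theorem outputs_append (t u : Trace) :
    Trace.outputs (t ++ u) = Trace.outputs t ++ Trace.outputs u := by
  simp [Trace.outputs, List.reduceOption_append]

theorem outputs_take_append_drop (t : Trace) (k : ℕ) :
    Trace.outputs (t.take k) ++ Trace.outputs (t.drop k) = Trace.outputs t := by
  rw [← outputs_append, List.take_append_drop]

theorem outputs_take_prefix (t : Trace) (k : ℕ) :
    Trace.outputs (t.take k) <+: Trace.outputs t :=
  ⟨_, outputs_take_append_drop t k⟩

theorem length_outputs_take_mono (t : Trace) {k l : ℕ} (h : k ≤ l) :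
    (Trace.outputs (t.take k)).length ≤ (Trace.outputs (t.take l)).length := by
  have := outputs_take_prefix (t.take l) k
  rw [List.take_take, min_eq_left h] at this
  exact this.length_le

end Trace

/-! ### Frame property -/

/-- All variables of the program are smaller than this number. -/
def Prog.bound : Prog → ℕ
  | .setNil x => x + 1
  | .copy x y => x + y + 1
  | .cons x y z => x + y + z + 1
  | .hd x y => x + y + 1
  | .tl x y => x + y + 1
  | .emit x => x + 1
  | .seq c d => max c.bound d.bound
  | .ite x c d => max (x + 1) (max c.bound d.bound)
  | .while x c => max (x + 1) c.bound

/-- Variables at or above the bound are never written, so a calling program can save values there.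
-/
theorem Exec.frame {c : Prog} {σ τ : Store} {t : Trace} (h : Exec c σ t τ) {x : ℕ}
    (hx : c.bound ≤ x) : τ x = σ x := by
  induction h with
  | emit => rfl
  | seq _ _ ih₁ ih₂ =>
    simp only [Prog.bound, max_le_iff] at hx
    rw [ih₂ hx.2, ih₁ hx.1]
  | iteTrue _ _ ih => simp only [Prog.bound, max_le_iff] at hx; exact ih hx.2.1
  | iteFalse _ _ ih => simp only [Prog.bound, max_le_iff] at hx; exact ih hx.2.2
  | whileTrue _ _ _ ih₁ ih₂ =>
    rw [ih₂ hx]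
    simp only [Prog.bound, max_le_iff] at hx
    exact ih₁ hx.2
  | whileFalse => rfl
  | _ => simp only [Prog.bound] at hx; exact Function.update_of_ne (by omega) _ _

/-! ### Polynomial-time transformations of trees -/

/-- Some program turns, for every index `a`, the tree `i a` in variable `0` into the tree `o a`,
without output and in time polynomial in `m a`. -/
def PolyTime {α : Type} (m : α → ℕ) (i o : α → BTree) : Prop :=
  ∃ (c : Prog) (T : α → ℕ), PolyBdd m T ∧ ∀ a σ, σ 0 = i a →
    ∃ t τ, Exec c σ t τ ∧ t.outputs = [] ∧ t.length ≤ T a ∧ τ 0 = o a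

namespace PolyTime

variable {α β : Type} {m : α → ℕ} {i f g o : α → BTree}

theorem congr (h : PolyTime m i o) (ho : ∀ a, o a = f a) : PolyTime m i f := by
  rwa [← funext ho]

theorem congr_left (h : PolyTime m i o) (hi : ∀ a, i a = f a) : PolyTime m f o := by
  rwa [← funext hi]

theorem id (m : α → ℕ) (i : α → BTree) : PolyTime m i i :=
  ⟨.copy 0 0, fun _ => 1, PolyBdd.const m 1, fun a σ h => ⟨_, _, Exec.copy 0 0 σ, by simp, by simp,
    by simpa using h⟩⟩

/-- Time is measured in the index `a` rather than in the size of a tree, so no bound on the size of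
the intermediate tree is needed. -/
theorem comp (h₁ : PolyTime m i f) (h₂ : PolyTime m f o) : PolyTime m i o := by
  obtain ⟨c, T, hT, hc⟩ := h₁
  obtain ⟨d, S, hS, hd⟩ := h₂
  refine ⟨.seq c d, _, hT.add hS, fun a σ h => ?_⟩
  obtain ⟨t, τ, e₁, o₁, l₁, r₁⟩ := hc a σ h
  obtain ⟨u, ρ, e₂, o₂, l₂, r₂⟩ := hd a τ r₁
  exact ⟨_, _, e₁.seq e₂, by simp [o₁, o₂], by simpa using Nat.add_le_add l₁ l₂, r₂⟩

theorem hd (h : PolyTime m i f) : PolyTime m i fun a => (f a).hd :=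
  h.comp ⟨.hd 0 0, fun _ => 1, PolyBdd.const m 1, fun a σ h => ⟨_, _, Exec.hd 0 0 σ, by simp,
    by simp, by simp [h]⟩⟩

theorem tl (h : PolyTime m i f) : PolyTime m i fun a => (f a).tl :=
  h.comp ⟨.tl 0 0, fun _ => 1, PolyBdd.const m 1, fun a σ h => ⟨_, _, Exec.tl 0 0 σ, by simp,
    by simp, by simp [h]⟩⟩

theorem fst (h : PolyTime m i fun a => .cons (f a) (g a)) : PolyTime m i f := h.hd

theorem snd (h : PolyTime m i fun a => .cons (f a) (g a)) : PolyTime m i g := h.tl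

theorem nil : PolyTime m i fun _ => .nil :=
  ⟨.setNil 0, fun _ => 1, PolyBdd.const m 1, fun a σ h => ⟨_, _, Exec.setNil 0 σ, by simp,
    by simp, by simp⟩⟩

/-- The input is needed twice: variable `x` saves it while `c` runs, and `x + 1` saves the result of
`c` while `d` runs. -/
theorem cons (hf : PolyTime m i f) (hg : PolyTime m i g) :
    PolyTime m i fun a => .cons (f a) (g a) := by
  obtain ⟨c, T, hT, hc⟩ := hf
  obtain ⟨d, S, hS, hd⟩ := hg
  obtain ⟨x, hx₀, hx₁, hx₂⟩ : ∃ x, 0 < x ∧ c.bound ≤ x ∧ d.bound ≤ x :=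
    ⟨c.bound + d.bound + 1, by omega, by omega, by omega⟩
  refine ⟨.seq (.copy x 0) (.seq c (.seq (.copy (x + 1) 0) (.seq (.copy 0 x)
    (.seq d (.cons 0 (x + 1) 0))))), fun a => T a + S a + 4, (hT.add hS).add (PolyBdd.const m 4),
    fun a σ h => ?_⟩
  obtain ⟨t, τ, e₁, o₁, l₁, r₁⟩ := hc a (Function.update σ x (σ 0))
    (by rw [Function.update_of_ne (by omega), h])
  have hx : τ x = i a := by rw [e₁.frame hx₁]; simp [h]
  obtain ⟨u, ρ, e₂, o₂, l₂, r₂⟩ := hd a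
    (Function.update (Function.update τ (x + 1) (τ 0)) 0 (Function.update τ (x + 1) (τ 0) x))
    (by simp [hx])
  have hy : ρ (x + 1) = f a := by
    rw [e₂.frame (by omega)]
    simp [r₁]
  refine ⟨_, _, (Exec.copy x 0 σ).seq (e₁.seq ((Exec.copy (x + 1) 0 τ).seq
    ((Exec.copy 0 x _).seq (e₂.seq (Exec.cons 0 (x + 1) 0 ρ))))), by simp [o₁, o₂], ?_,
    by simp [hy, r₂]⟩
  simp only [List.length_append, List.length_singleton]
  omega

/-- Case distinction on a computed tree. -/
theorem cases {x : α → BTree} (hx : PolyTime m i x)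
    (hf : PolyTime (fun a : {a // x a ≠ .nil} => m a) (fun a => i a) (fun a => f a))
    (hg : PolyTime (fun a : {a // x a = .nil} => m a) (fun a => i a) (fun a => f a)) :
    PolyTime m i f := by
  obtain ⟨c, T, hT, hc⟩ := hx.cons (PolyTime.id m i)
  obtain ⟨d, S, ⟨ds, hS⟩, hd⟩ := hf
  obtain ⟨e, R, ⟨dr, hR⟩, he⟩ := hg
  -- `S` and `R` are defined only on their own halves of `α`; these powers dominate them and make
  -- sense for every index.
  have hS' : PolyBdd m fun a => (m a + 2) ^ ds := ⟨ds, fun a => le_rfl⟩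
  have hR' : PolyBdd m fun a => (m a + 2) ^ dr := ⟨dr, fun a => le_rfl⟩
  refine ⟨.seq c (.seq (.hd 1 0) (.seq (.tl 0 0) (.ite 1 d e))), _,
    (hT.add (hS'.add hR')).add (PolyBdd.const m 3), fun a σ h => ?_⟩
  obtain ⟨t, τ, e₁, o₁, l₁, r₁⟩ := hc a σ h
  by_cases hxa : x a = .nil
  · obtain ⟨u, ρ, e₂, o₂, l₂, r₂⟩ := he ⟨a, hxa⟩
      (Function.update (Function.update τ 1 (τ 0).hd) 0 (Function.update τ 1 (τ 0).hd 0).tl)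
      (by simp [r₁])
    refine ⟨_, _, e₁.seq ((Exec.hd 1 0 τ).seq ((Exec.tl 0 0 _).seq
      (Exec.iteFalse (by simp [r₁, hxa]) e₂))), by simp [o₁, o₂], ?_, r₂⟩
    have := hR ⟨a, hxa⟩
    simp only [List.length_append, List.length_nil, List.length_cons] at *
    omega
  · obtain ⟨u, ρ, e₂, o₂, l₂, r₂⟩ := hd ⟨a, hxa⟩
      (Function.update (Function.update τ 1 (τ 0).hd) 0 (Function.update τ 1 (τ 0).hd 0).tl)
      (by simp [r₁])
    refine ⟨_, _, e₁.seq ((Exec.hd 1 0 τ).seq ((Exec.tl 0 0 _).seq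
      (Exec.iteTrue (by simp [r₁, hxa]) e₂))), by simp [o₁, o₂], ?_, r₂⟩
    have := hS ⟨a, hxa⟩
    simp only [List.length_append, List.length_nil, List.length_cons] at *
    omega

theorem reindex (φ : β → α) (h : PolyTime m i o) :
    PolyTime (fun b => m (φ b)) (fun b => i (φ b)) (fun b => o (φ b)) := by
  obtain ⟨c, T, hT, hc⟩ := h
  exact ⟨c, _, hT.reindex φ, fun b => hc (φ b)⟩

theorem measure {m' : α → ℕ} (h : PolyTime m i o) (hm : PolyBdd m' m) : PolyTime m' i o := by
  obtain ⟨c, T, hT, hc⟩ := h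
  exact ⟨c, _, hT.trans hm, hc⟩

theorem ite {p : α → Prop} [DecidablePred p] (hp : PolyTime m i fun a => .bit (p a))
    (hf : PolyTime m i f) (hg : PolyTime m i g) :
    PolyTime m i fun a => if p a then f a else g a := by
  refine hp.cases ((hf.reindex Subtype.val).congr fun a => ?_)
    ((hg.reindex Subtype.val).congr fun a => ?_)
  · have := a.2; simp at this; simp [this]
  · have := a.2; simp at this; simp [this]

theorem bit_ne_nil (hf : PolyTime m i f) : PolyTime m i fun a => .bit (f a ≠ .nil) := by
  refine hf.cases ((nil.cons nil).congr fun a => ?_) (nil.congr fun a => ?_)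
  · have := a.2; simp [this]
  · have := a.2; simp [this]

theorem bit_not {p : α → Prop} (hp : PolyTime m i fun a => .bit (p a)) :
    PolyTime m i fun a => .bit (¬ p a) := by
  classical
  refine (hp.ite nil (nil.cons nil)).congr fun a => ?_
  by_cases h : p a <;> simp [h]

theorem bit_and {p q : α → Prop} (hp : PolyTime m i fun a => .bit (p a))
    (hq : PolyTime m i fun a => .bit (q a)) : PolyTime m i fun a => .bit (p a ∧ q a) := by
  classical
  refine (hp.ite hq nil).congr fun a => ?_
  by_cases h : p a <;> simp [h]

theorem bit_or {p q : α → Prop} (hp : PolyTime m i fun a => .bit (p a))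
    (hq : PolyTime m i fun a => .bit (q a)) : PolyTime m i fun a => .bit (p a ∨ q a) := by
  classical
  refine (hp.ite (nil.cons nil) hq).congr fun a => ?_
  by_cases h : p a <;> simp [h]

/-- Iteration of a step, as long as the left subtree of the state is not `nil`. -/
theorem loop {N : α → ℕ} (st : α → ℕ → BTree) (hN : PolyBdd m N)
    (h₁ : ∀ a j, j < N a → (st a j).hd ≠ .nil) (h₂ : ∀ a, (st a (N a)).hd = .nil)
    (h : PolyTime (fun p : {p : α × ℕ // p.2 < N p.1} => m p.1.1)
      (fun p => st p.1.1 p.1.2) (fun p => st p.1.1 (p.1.2 + 1))) :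
    PolyTime m (fun a => st a 0) (fun a => st a (N a)) := by
  obtain ⟨c, T, ⟨d, hT⟩, hc⟩ := h
  -- `k` rounds remain after `j` are done. Variable `1` mirrors the left subtree of the state, since
  -- a loop can only test a variable.
  have key : ∀ a k j, k + j = N a → ∀ σ : Store, σ 0 = st a j → σ 1 = (st a j).hd →
      ∃ t τ, Exec (.while 1 (.seq c (.hd 1 0))) σ t τ ∧ t.outputs = [] ∧
        t.length ≤ k * ((m a + 2) ^ d + 2) + 1 ∧ τ 0 = st a (N a) := by
    intro a k
    induction k with
    | zero =>
      intro j hj σ h0 h1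
      obtain rfl : j = N a := by omega
      exact ⟨_, _, Exec.whileFalse (by rw [h1, h₂]), by simp, by simp, h0⟩
    | succ k ih =>
      intro j hj σ h0 h1
      have hlt : j < N a := by omega
      obtain ⟨t, τ, e₁, o₁, l₁, r₁⟩ := hc ⟨(a, j), hlt⟩ σ h0
      obtain ⟨u, ρ, e₂, o₂, l₂, r₂⟩ := ih (j + 1) (by omega) (Function.update τ 1 (τ 0).hd)
        (by simpa using r₁) (by simp [r₁])
      refine ⟨_, _, Exec.whileTrue (by rw [h1]; exact h₁ a j hlt) (e₁.seq (Exec.hd 1 0 τ)) e₂,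
        by simp [o₁, o₂], ?_, r₂⟩
      have := hT ⟨(a, j), hlt⟩
      simp only [List.length_append, List.length_nil, List.length_cons] at *
      rw [add_mul]
      omega
  have hd' : PolyBdd m fun a => (m a + 2) ^ d := ⟨d, fun a => le_rfl⟩
  refine ⟨.seq (.hd 1 0) (.while 1 (.seq c (.hd 1 0))), _,
    ((hN.mul (hd'.add (PolyBdd.const m 2))).add (PolyBdd.const m 2)), fun a σ h => ?_⟩
  obtain ⟨u, ρ, e₂, o₂, l₂, r₂⟩ := key a (N a) 0 rfl (Function.update σ 1 (σ 0).hd)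
    (by simpa using h) (by simp [h])
  refine ⟨_, _, (Exec.hd 1 0 σ).seq e₂, by simp [o₂], ?_, r₂⟩
  simp only [List.length_append, List.length_singleton]
  omega

end PolyTime

/-! ### Running a program with a clock -/

namespace Prog

/-- `c`, as one step of a clocked program: skipped when the clock `b` has run out. -/
def guarded (b : ℕ) (c : Prog) : Prog := .ite b (.seq (.tl b b) c) (.copy b b)

/-- The test of a loop as a step of a clocked program: `b + 2` becomes `nil` when the clock `b`
has run out. -/
def guardedTest (b x : ℕ) : Prog :=
  .ite b (.seq (.tl b b) (.copy (b + 2) x)) (.setNil (b + 2))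

/-- The program that runs like `c` for as many steps as the list in variable `b` has elements,
and collects the outputs in variable `b + 1`. -/
def clocked (b : ℕ) : Prog → Prog
  | .setNil x => guarded b (.setNil x)
  | .copy x y => guarded b (.copy x y)
  | .cons x y z => guarded b (.cons x y z)
  | .hd x y => guarded b (.hd x y)
  | .tl x y => guarded b (.tl x y)
  | .emit x => guarded b (.cons (b + 1) x (b + 1))
  | .seq c d => .seq (clocked b c) (clocked b d)
  | .ite x c d => guarded b (.ite x (clocked b c) (clocked b d))
  | .while x c =>
    .seq (guardedTest b x) (.while (b + 2) (.seq (clocked b c) (guardedTest b x)))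

/-- The overhead of clocking. -/
def overhead : Prog → ℕ
  | .seq c d => c.overhead + d.overhead
  | .ite _ c d => c.overhead + d.overhead + 3
  | .while _ c => c.overhead + 10
  | _ => 3

/-- Set the variables `1, …, k` to `nil`. -/
def clear : ℕ → Prog
  | 0 => .copy 0 0
  | k + 1 => .seq (clear k) (.setNil (k + 1))

end Prog

/-! ### Correctness of clocked execution -/

theorem Exec.guarded_live {b B : ℕ} {c : Prog} {σ τ : Store} {t : Trace}
    (hb : σ b = .unary (B + 1)) (h : Exec c (Function.update σ b (.unary B)) t τ) :
    Exec (c.guarded b) σ (none :: none :: t) τ := by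
  have h1 := Exec.tl b b σ
  rw [hb] at h1
  exact Exec.iteTrue (by simp [hb]) (h1.seq h)

theorem Exec.guarded_dead {b : ℕ} {c : Prog} {σ : Store} (hb : σ b = .nil) :
    Exec (c.guarded b) σ [none, none] σ := by
  have h1 := Exec.copy b b σ
  rw [Function.update_eq_self] at h1
  exact Exec.iteFalse hb h1

theorem Exec.guardedTest_live {b B x : ℕ} {σ : Store} (hx : x < b)
    (hb : σ b = .unary (B + 1)) :
    Exec (Prog.guardedTest b x) σ [none, none, none]
      (Function.update (Function.update σ b (.unary B)) (b + 2) (σ x)) := by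
  have h1 := Exec.tl b b σ
  rw [hb] at h1
  have h2 := Exec.copy (b + 2) x (Function.update σ b (.unary B))
  rw [Function.update_of_ne hx.ne] at h2
  exact Exec.iteTrue (by simp [hb]) (h1.seq h2)

theorem Exec.guardedTest_dead {b x : ℕ} {σ : Store} (hb : σ b = .nil) :
    Exec (Prog.guardedTest b x) σ [none, none] (Function.update σ (b + 2) .nil) :=
  Exec.iteFalse hb (Exec.setNil _ _)

/-- Once the clock is `nil`, guarded commands are skipped and loop tests fail at once, so the rest
of the program costs only its overhead and adds no output. -/
theorem Exec.clocked_dead (b : ℕ) (c : Prog) : ∀ σ : Store, σ b = .nil →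
    ∃ t τ, Exec (c.clocked b) σ t τ ∧ t.outputs = [] ∧ t.length ≤ c.overhead ∧ τ b = .nil ∧
      τ (b + 1) = σ (b + 1) := by
  induction c with
  | seq c d ihc ihd =>
    intro σ hσ
    obtain ⟨t, τ, e₁, o₁, l₁, b₁, r₁⟩ := ihc σ hσ
    obtain ⟨u, ρ, e₂, o₂, l₂, b₂, r₂⟩ := ihd τ b₁
    refine ⟨_, _, e₁.seq e₂, by simp [o₁, o₂], ?_, b₂, r₂.trans r₁⟩
    simp only [Prog.overhead, List.length_append]
    omega
  | setNil | copy | cons | hd | tl | emit | ite =>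
    intro σ hσ
    exact ⟨_, _, Exec.guarded_dead hσ, by simp, by simp [Prog.overhead], hσ, rfl⟩
  | _ =>
    intro σ hσ
    exact ⟨_, _, (Exec.guardedTest_dead hσ).seq (Exec.whileFalse (by simp)), by simp,
      by simp [Prog.overhead], by simpa using hσ, by simp⟩

/-- The common shape of the one-step commands: `v` is the trace entry of the original step, whereas
the clocked command emits nothing and stores the output in variable `b + 1`. -/
theorem Exec.clocked_prim {b B : ℕ} {σ' τ τ' : Store} {c : Prog} {l : List BTree}
    {v : Option BTree} (hl : σ' (b + 1) = .ofList l) (hB : σ' b = .unary B)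
    (h : Exec c (Function.update σ' b (.unary (B - 1))) [none] τ')
    (h₁ : τ' b = .unary (B - 1)) (h₂ : τ' (b + 1) = .ofList (Trace.outputs [v] ++ l))
    (h₃ : ∀ y < b, τ' y = τ y) :
    ∃ t' τ', Exec (c.guarded b) σ' t' τ' ∧ t'.outputs = [] ∧
      t'.length ≤ 3 * (min [v].length B + 1) ∧ τ' b = .unary (B - [v].length) ∧
      τ' (b + 1) = .ofList ((Trace.outputs (List.take B [v])).reverse ++ l) ∧
      ([v].length ≤ B → ∀ x < b, τ' x = τ x) := by
  cases B with
  | zero => exact ⟨_, _, Exec.guarded_dead hB, by simp, by simp, hB, by simp [hl], by simp⟩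
  | succ B =>
    refine ⟨_, _, Exec.guarded_live hB h, by simp, by simp, by simpa using h₁, ?_, fun _ => h₃⟩
    cases v <;> simpa using h₂

theorem Store.agree_update {b B : ℕ} {σ σ' : Store} (x : ℕ) (v : BTree)
    (h : ∀ y < b, σ' y = σ y) :
    ∀ y < b, Function.update (Function.update σ' b (.unary B)) x v y =
      Function.update σ x v y := by
  intro y hy
  rcases eq_or_ne y x with rfl | hne
  · simp
  · rw [Function.update_of_ne hne, Function.update_of_ne hne, Function.update_of_ne hy.ne,
      h y hy]

/-- Induction on the original computation, for all clock values. The stores agree below `b` only if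
the clock suffices; when it runs out midway, `Exec.clocked_dead` or a failing loop test finishes the
run. The `+ 1` in the cost pays for skipped commands. -/
theorem Exec.clocked {b : ℕ} {c : Prog} {σ τ : Store} {t : Trace} (h : Exec c σ t τ)
    (hb : c.bound ≤ b) {σ' : Store} (hσ : ∀ x < b, σ' x = σ x) {B : ℕ} (hB : σ' b = .unary B)
    {l : List BTree} (hl : σ' (b + 1) = .ofList l) :
    ∃ t' τ', Exec (c.clocked b) σ' t' τ' ∧ t'.outputs = [] ∧
      t'.length ≤ c.overhead * (min t.length B + 1) ∧ τ' b = .unary (B - t.length) ∧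
      τ' (b + 1) = .ofList ((Trace.outputs (t.take B)).reverse ++ l) ∧
      (t.length ≤ B → ∀ x < b, τ' x = τ x) := by
  induction h generalizing σ' B l with
  | setNil x σ =>
    simp only [Prog.bound] at hb
    exact Exec.clocked_prim (v := none) hl hB (Exec.setNil x _)
      (by rw [Function.update_of_ne (by omega)]; simp)
      (by rw [Function.update_of_ne (by omega), Function.update_of_ne (by omega)]; simpa using hl)
      (Store.agree_update _ _ hσ)
  | copy x y σ =>
    simp only [Prog.bound] at hb
    refine Exec.clocked_prim (v := none) hl hB (Exec.copy x y _)
      (by rw [Function.update_of_ne (by omega)]; simp)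
      (by rw [Function.update_of_ne (by omega), Function.update_of_ne (by omega)]; simpa using hl)
      ?_
    rw [Function.update_of_ne (by omega : y ≠ b), hσ y (by omega)]
    exact Store.agree_update _ _ hσ
  | cons x y z σ =>
    simp only [Prog.bound] at hb
    refine Exec.clocked_prim (v := none) hl hB (Exec.cons x y z _)
      (by rw [Function.update_of_ne (by omega)]; simp)
      (by rw [Function.update_of_ne (by omega), Function.update_of_ne (by omega)]; simpa using hl)
      ?_
    rw [Function.update_of_ne (by omega : y ≠ b), hσ y (by omega),
      Function.update_of_ne (by omega : z ≠ b), hσ z (by omega)]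
    exact Store.agree_update _ _ hσ
  | hd x y σ =>
    simp only [Prog.bound] at hb
    refine Exec.clocked_prim (v := none) hl hB (Exec.hd x y _)
      (by rw [Function.update_of_ne (by omega)]; simp)
      (by rw [Function.update_of_ne (by omega), Function.update_of_ne (by omega)]; simpa using hl)
      ?_
    rw [Function.update_of_ne (by omega : y ≠ b), hσ y (by omega)]
    exact Store.agree_update _ _ hσ
  | tl x y σ =>
    simp only [Prog.bound] at hb
    refine Exec.clocked_prim (v := none) hl hB (Exec.tl x y _)
      (by rw [Function.update_of_ne (by omega)]; simp)
      (by rw [Function.update_of_ne (by omega), Function.update_of_ne (by omega)]; simpa using hl)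
      ?_
    rw [Function.update_of_ne (by omega : y ≠ b), hσ y (by omega)]
    exact Store.agree_update _ _ hσ
  | emit x σ =>
    simp only [Prog.bound] at hb
    refine Exec.clocked_prim (v := some (σ x)) hl hB (Exec.cons (b + 1) x (b + 1) _)
      (by rw [Function.update_of_ne (by omega)]; simp) ?_ ?_
    · rw [Function.update_self, Function.update_of_ne (by omega : x ≠ b), hσ x (by omega),
        Function.update_of_ne (by omega), hl]
      simp
    · intro y hy
      rw [Function.update_of_ne (by omega), Function.update_of_ne (by omega), hσ y hy]
  | @seq c d σ₁ σ₂ σ₃ t u h₁ h₂ ih₁ ih₂ =>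
    simp only [Prog.bound, max_le_iff] at hb
    obtain ⟨t', τ', e₁, o₁, l₁, b₁, r₁, a₁⟩ := ih₁ hb.1 hσ hB hl
    rcases le_or_gt t.length B with hle | hlt
    · obtain ⟨u', ρ', e₂, o₂, l₂, b₂, r₂, a₂⟩ := ih₂ hb.2 (a₁ hle) b₁ r₁
      refine ⟨_, _, e₁.seq e₂, by simp [o₁, o₂], ?_, ?_, ?_, ?_⟩
      · rw [min_eq_left hle] at l₁
        have : min (t ++ u).length B = t.length + min u.length (B - t.length) := by
          simp only [List.length_append]; omega
        rw [this]
        simp only [List.length_append, Prog.overhead]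
        nlinarith [Nat.zero_le (c.overhead * min u.length (B - t.length)),
          Nat.zero_le (d.overhead * t.length)]
      · rw [b₂]; congr 1; simp only [List.length_append]; omega
      · rw [r₂, List.take_append, Trace.outputs_append, List.take_of_length_le hle]
        simp
      · intro h
        simp only [List.length_append] at h
        exact a₂ (by omega)
    · obtain ⟨u', ρ', e₂, o₂, l₂, b₂, r₂⟩ := Exec.clocked_dead b d τ' (by rw [b₁]; simp; omega)
      refine ⟨_, _, e₁.seq e₂, by simp [o₁, o₂], ?_, ?_, ?_, ?_⟩
      · have h1 : min (t ++ u).length B = B := by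
          simp only [List.length_append]; omega
        rw [min_eq_right hlt.le] at l₁
        rw [h1]
        simp only [List.length_append, Prog.overhead]
        nlinarith [Nat.zero_le (d.overhead * B)]
      · rw [b₂]; symm; simp only [List.length_append, BTree.unary_eq_nil]; omega
      · rw [r₂, r₁, List.take_append_of_le_length hlt.le]
      · intro h
        simp only [List.length_append] at h
        omega
  | @iteTrue x c d σ₁ σ₂ t hx h ih =>
    simp only [Prog.bound, max_le_iff] at hb
    cases B with
    | zero => exact ⟨_, _, Exec.guarded_dead hB, by simp, by simp [Prog.overhead], by simp [hB],
        by simp [hl], by simp⟩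
    | succ B =>
      obtain ⟨t', τ', e₁, o₁, l₁, b₁, r₁, a₁⟩ := ih hb.2.1
        (σ' := Function.update σ' b (.unary B)) (B := B) (l := l)
        (by intro y hy; rw [Function.update_of_ne hy.ne, hσ y hy]) (by simp) (by simp [hl])
      refine ⟨_, _, Exec.guarded_live hB (Exec.iteTrue ?_ e₁), by simp [o₁], ?_, ?_, ?_, ?_⟩
      · rwa [Function.update_of_ne (by omega), hσ x (by omega)]
      · have : min (none :: t).length (B + 1) = min t.length B + 1 := by
          simp only [List.length_cons]; omega
        rw [this]
        simp only [List.length_cons, Prog.overhead]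
        have : (c.overhead + d.overhead + 3) * (min t.length B + 1 + 1) =
            c.overhead * (min t.length B + 1) + (c.overhead +
              d.overhead * (min t.length B + 2) + 3 * (min t.length B + 2)) := by ring
        omega
      · rw [b₁]; simp
      · rw [r₁]; simp
      · intro h; exact a₁ (by simpa using h)
  | @iteFalse x c d σ₁ σ₂ t hx h ih =>
    simp only [Prog.bound, max_le_iff] at hb
    cases B with
    | zero => exact ⟨_, _, Exec.guarded_dead hB, by simp, by simp [Prog.overhead], by simp [hB],
        by simp [hl], by simp⟩
    | succ B =>
      obtain ⟨t', τ', e₁, o₁, l₁, b₁, r₁, a₁⟩ := ih hb.2.2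
        (σ' := Function.update σ' b (.unary B)) (B := B) (l := l)
        (by intro y hy; rw [Function.update_of_ne hy.ne, hσ y hy]) (by simp) (by simp [hl])
      refine ⟨_, _, Exec.guarded_live hB (Exec.iteFalse ?_ e₁), by simp [o₁], ?_, ?_, ?_, ?_⟩
      · rwa [Function.update_of_ne (by omega), hσ x (by omega)]
      · have : min (none :: t).length (B + 1) = min t.length B + 1 := by
          simp only [List.length_cons]; omega
        rw [this]
        simp only [List.length_cons, Prog.overhead]
        have : (c.overhead + d.overhead + 3) * (min t.length B + 1 + 1) =
            d.overhead * (min t.length B + 1) + (d.overhead +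
              c.overhead * (min t.length B + 2) + 3 * (min t.length B + 2)) := by ring
        omega
      · rw [b₁]; simp
      · rw [r₁]; simp
      · intro h; exact a₁ (by simpa using h)
  | @whileTrue x c σ₁ σ₂ σ₃ t u hx h₁ h₂ ih₁ ih₂ =>
    have hb' := hb
    simp only [Prog.bound, max_le_iff] at hb
    cases B with
    | zero => exact ⟨_, _, (Exec.guardedTest_dead hB).seq (Exec.whileFalse (by simp)), by simp,
        by simp [Prog.overhead], by simp [hB], by simp [hl], by simp⟩
    | succ B =>
      have hσ'' : ∀ y < b, Function.update (Function.update σ' b (.unary B)) (b + 2) (σ' x) y =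
          σ₁ y := by
        intro y hy
        rw [Function.update_of_ne (by omega), Function.update_of_ne (by omega), hσ y hy]
      obtain ⟨t', τ', e₁, o₁, l₁, b₁, r₁, a₁⟩ := ih₁ hb.2 hσ'' (B := B) (l := l)
        (by simp) (by simp [hl])
      have ht : (Function.update (Function.update σ' b (.unary B)) (b + 2) (σ' x)) (b + 2) ≠
          .nil := by rwa [Function.update_self, hσ x (by omega)]
      rcases le_or_gt t.length B with hle | hlt
      · obtain ⟨u', ρ', e₂, o₂, l₂, b₂, r₂, a₂⟩ := ih₂ hb' (a₁ hle) b₁ r₁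
        -- The induction hypothesis runs a test followed by the loop; that test is the end of the
        -- present loop body, so the run is cut there and regrouped.
        cases e₂ with
        | @seq _ _ _ τ'' _ u₁ u₂ e₂ e₃ =>
          refine ⟨_, _, (Exec.guardedTest_live (by omega) hB).seq
            (Exec.whileTrue ht (e₁.seq e₂) e₃), ?_, ?_, ?_, ?_, ?_⟩
          · simpa [o₁] using o₂
          · rw [min_eq_left hle] at l₁
            have : min (none :: (t ++ u)).length (B + 1) =
                1 + t.length + min u.length (B - t.length) := by
              simp only [List.length_append, List.length_cons]; omega
            rw [this]
            simp only [List.length_append, List.length_cons, List.length_nil, Prog.overhead] at l₂ ⊢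
            nlinarith
          · rw [b₂]; congr 1; simp only [List.length_append, List.length_cons]; omega
          · rw [r₂, List.take_succ_cons, List.take_append, Trace.outputs_cons_none,
              Trace.outputs_append, List.take_of_length_le hle]
            simp
          · intro h
            simp only [List.length_append, List.length_cons] at h
            exact a₂ (by omega)
      · refine ⟨_, _, (Exec.guardedTest_live (by omega) hB).seq
            (Exec.whileTrue ht (e₁.seq (Exec.guardedTest_dead ?_)) (Exec.whileFalse ?_)),
            ?_, ?_, ?_, ?_, ?_⟩
        · rw [b₁]; simp; omega
        · simp
        · simp [o₁]
        · have h1 : min (none :: (t ++ u)).length (B + 1) = B + 1 := by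
            simp only [List.length_append, List.length_cons]; omega
          rw [min_eq_right hlt.le] at l₁
          rw [h1]
          simp only [List.length_append, List.length_cons, List.length_nil, Prog.overhead]
          nlinarith
        · rw [Function.update_of_ne (by omega), b₁]
          congr 1; simp only [List.length_append, List.length_cons]; omega
        · rw [Function.update_of_ne (by omega), r₁, List.take_succ_cons,
            Trace.outputs_cons_none, List.take_append_of_le_length hlt.le]
        · intro h
          simp only [List.length_append, List.length_cons] at h
          omega
  | @whileFalse x c σ hx =>
    simp only [Prog.bound, max_le_iff] at hb
    cases B with
    | zero => exact ⟨_, _, (Exec.guardedTest_dead hB).seq (Exec.whileFalse (by simp)), by simp,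
        by simp [Prog.overhead], by simp [hB], by simp [hl], by simp⟩
    | succ B =>
      refine ⟨_, _, (Exec.guardedTest_live (by omega) hB).seq (Exec.whileFalse ?_), by simp, ?_,
        by simp, by simp [hl], ?_⟩
      · rw [Function.update_self, hσ x (by omega), hx]
      · have : min ([none] : Trace).length (B + 1) = 1 := by simp
        rw [this]
        simp only [Prog.overhead, List.length_append, List.length_cons, List.length_nil]
        omega
      · intro _ y hy
        rw [Function.update_of_ne (by omega), Function.update_of_ne (by omega), hσ y hy]

theorem Exec.clear (k : ℕ) (σ : Store) : ∃ t τ, Exec (Prog.clear k) σ t τ ∧ t.outputs = [] ∧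
    t.length = k + 1 ∧ ∀ x, τ x = if 0 < x ∧ x ≤ k then .nil else σ x := by
  induction k with
  | zero => exact ⟨_, _, Exec.copy 0 0 σ, by simp, by simp, by simp; omega⟩
  | succ k ih =>
    obtain ⟨t, τ, e, o, l, r⟩ := ih
    refine ⟨_, _, e.seq (Exec.setNil (k + 1) τ), by simp [o], by simp [l], fun x => ?_⟩
    rcases eq_or_ne x (k + 1) with rfl | hne
    · simp
    · rw [Function.update_of_ne hne, r]
      exact if_congr (by omega) rfl rfl

/-- A program can be run for a polynomial number of steps; the result is the list of the values
output in these steps, in reverse order, and the list of the steps that are left. -/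
theorem PolyTime.simulate {α : Type} {m : α → ℕ} {i v : α → BTree} (c : Prog) {tr : α → Trace}
    (htr : ∀ a, ∃ τ, Exec c (initStore (v a)) (tr a) τ) {B : α → ℕ} (hB : PolyBdd m B)
    (hv : PolyTime m i v) (hi : PolyTime m i fun a => .unary (B a)) :
    PolyTime m i fun a => .cons (.ofList (Trace.outputs ((tr a).take (B a))).reverse)
      (.unary (B a - (tr a).length)) := by
  refine (hv.cons hi).comp ?_
  -- With this `b`, clearing `1, …, c.bound` restores the initial store on all variables below `b`
  -- and leaves the input in `0`, the clock in `b` and the output list in `b + 1` alone.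
  set b := c.bound + 1 with hb
  refine ⟨.seq (.tl b 0) (.seq (.hd 0 0) (.seq (.setNil (b + 1)) (.seq (.clear c.bound)
    (.seq (c.clocked b) (.cons 0 (b + 1) b))))),
    fun a => c.overhead * (B a + 1) + (c.bound + 5),
    ((PolyBdd.const m _).mul (hB.add (PolyBdd.const m 1))).add (PolyBdd.const m _),
    fun a σ h => ?_⟩
  obtain ⟨τ, e⟩ := htr a
  obtain ⟨t₁, τ₁, e₁, o₁, l₁, r₁⟩ := Exec.clear c.bound (Function.update (Function.update
    (Function.update σ b (σ 0).tl) 0 (Function.update σ b (σ 0).tl 0).hd) (b + 1) .nil)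
  obtain ⟨t₂, τ₂, e₂, o₂, l₂, b₂, r₂, a₂⟩ := e.clocked (b := b) (by omega) (σ' := τ₁)
    (B := B a) (l := []) (by
      intro x hx
      rw [r₁, initStore]
      rcases Nat.eq_zero_or_pos x with rfl | hpos
      · rw [if_neg (by omega), if_pos rfl, Function.update_of_ne (by omega), Function.update_self,
          Function.update_of_ne (by omega), h, BTree.hd_cons]
      · rw [if_pos (by omega), if_neg (by omega)])
    (by rw [r₁, if_neg (by omega), Function.update_of_ne (by omega),
          Function.update_of_ne (by omega), Function.update_self, h, BTree.tl_cons])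
    (by rw [r₁, if_neg (by omega), Function.update_self]; rfl)
  refine ⟨_, _, (Exec.tl b 0 σ).seq ((Exec.hd 0 0 _).seq ((Exec.setNil (b + 1) _).seq
    (e₁.seq (e₂.seq (Exec.cons 0 (b + 1) b τ₂))))), by simp [o₁, o₂], ?_, by simp [b₂, r₂]⟩
  have : c.overhead * (min (tr a).length (B a) + 1) ≤ c.overhead * (B a + 1) := by gcongr; simp
  simp only [List.length_append, List.length_singleton]
  omega

/-! ### Polynomial-time operations on lists -/

namespace PolyTime

variable {α : Type} {m : α → ℕ} {i f g : α → BTree} {β γ δ : α → Type}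

/-- A loop whose state is the rest of the list, the accumulator and the context; it stops when the
rest is `nil`. Indexing the accumulator by the position lets folds, unary arithmetic and matrices
all be instances. -/
theorem foldIdx (L : α → List BTree) (acc : α → ℕ → BTree)
    (hn : PolyBdd m fun a => (L a).length) (hL : PolyTime m i fun a => .ofList (L a))
    (h₀ : PolyTime m i fun a => acc a 0)
    (h : PolyTime (fun p : {p : α × ℕ // p.2 < (L p.1).length} => m p.1.1)
      (fun p => .cons ((L p.1.1)[p.1.2]'p.2) (.cons (acc p.1.1 p.1.2) (i p.1.1)))
      (fun p => acc p.1.1 (p.1.2 + 1))) :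
    PolyTime m i fun a => acc a (L a).length := by
  refine ((hL.cons (h₀.cons (PolyTime.id m i))).comp
    (f := fun a => .cons (.ofList ((L a).drop 0)) (.cons (acc a 0) (i a))) ?_).comp
    (loop (fun a j => .cons (.ofList ((L a).drop j)) (.cons (acc a j) (i a))) hn ?_ ?_ ?_)
    |>.snd |>.fst
  · exact (PolyTime.id _ _).congr fun a => by simp
  · intro a j hj; simpa using hj
  · intro a; simp
  · have hctx : PolyTime (fun p : {p : α × ℕ // p.2 < (L p.1).length} => m p.1.1)
        (fun p => .cons (.ofList ((L p.1.1).drop p.1.2)) (.cons (acc p.1.1 p.1.2) (i p.1.1)))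
        (fun p => .cons (.cons ((L p.1.1)[p.1.2]'p.2) (.ofList ((L p.1.1).drop (p.1.2 + 1))))
          (.cons (acc p.1.1 p.1.2) (i p.1.1))) :=
      (PolyTime.id _ _).congr fun p => by
        rw [List.drop_eq_getElem_cons p.2, BTree.ofList_cons]
    exact hctx.fst.snd.cons (((hctx.fst.fst.cons hctx.snd).comp h).cons hctx.snd.snd)

/-- The left fold of a polynomial-time function over a list. -/
theorem foldl (l : ∀ a, List (β a)) (eb : ∀ a, β a → BTree) (eg : ∀ a, γ a → BTree)
    (F : ∀ a, γ a → β a → γ a) (g₀ : ∀ a, γ a)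
    (hn : PolyBdd m fun a => (l a).length)
    (hl : PolyTime m i fun a => .ofList ((l a).map (eb a)))
    (h₀ : PolyTime m i fun a => eg a (g₀ a))
    (h : PolyTime (fun p : Σ a, γ a × β a => m p.1)
      (fun p => .cons (eb p.1 p.2.2) (.cons (eg p.1 p.2.1) (i p.1)))
      (fun p => eg p.1 (F p.1 p.2.1 p.2.2))) :
    PolyTime m i fun a => eg a ((l a).foldl (F a) (g₀ a)) := by
  refine (foldIdx (fun a => (l a).map (eb a))
    (fun a j => eg a (((l a).take j).foldl (F a) (g₀ a))) (by simpa using hn) hl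
    (by simpa using h₀) ?_).congr fun a => by simp
  have hlt : ∀ p : {p : α × ℕ // p.2 < ((l p.1).map (eb p.1)).length},
      p.1.2 < (l p.1.1).length := fun p => by simpa using p.2
  refine PolyTime.congr (PolyTime.congr_left
    (h.reindex (β := {p : α × ℕ // p.2 < ((l p.1).map (eb p.1)).length}) fun p =>
      ⟨p.1.1, ((l p.1.1).take p.1.2).foldl (F p.1.1) (g₀ p.1.1), (l p.1.1)[p.1.2]'(hlt p)⟩)
    fun p => ?_) fun p => ?_
  · simp
  simp only [List.take_succ_eq_append_getElem (hlt p), List.foldl_append, List.foldl_cons,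
    List.foldl_nil]

theorem reverse (l : α → List BTree) (hn : PolyBdd m fun a => (l a).length)
    (hl : PolyTime m i fun a => .ofList (l a)) :
    PolyTime m i fun a => .ofList (l a).reverse := by
  refine (foldl (β := fun _ => BTree) (γ := fun _ => List BTree) l (fun _ b => b)
    (fun _ l => .ofList l) (fun _ acc b => b :: acc) (fun _ => []) hn (by simpa using hl)
    PolyTime.nil ?_).congr fun a => ?_
  · have := PolyTime.id (fun p : Σ _ : α, List BTree × BTree => m p.1)
      (fun p => .cons p.2.2 (.cons (.ofList p.2.1) (i p.1)))
    exact this.fst.cons this.snd.fst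
  · congr 1
    simp

/-- A property of elements of a list in context, with an accumulator added to the context. -/
theorem accum {eb : ∀ a, β a → BTree} (eg : ∀ a, γ a → BTree) {o : (Σ a, β a) → BTree}
    (h : PolyTime (fun p : Σ a, β a => m p.1) (fun p => .cons (eb p.1 p.2) (i p.1)) o) :
    PolyTime (fun p : Σ a, γ a × β a => m p.1)
      (fun p => .cons (eb p.1 p.2.2) (.cons (eg p.1 p.2.1) (i p.1)))
      (fun p => o ⟨p.1, p.2.2⟩) := by
  have := PolyTime.id (fun p : Σ a, γ a × β a => m p.1)
    (fun p => .cons (eb p.1 p.2.2) (.cons (eg p.1 p.2.1) (i p.1)))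
  exact (this.fst.cons this.snd.snd).comp
    (h.reindex (β := Σ a, γ a × β a) fun p => ⟨p.1, p.2.2⟩)

open Classical in
theorem filterMap (l : ∀ a, List (β a)) (eb : ∀ a, β a → BTree) (q : ∀ a, β a → Prop)
    (r : ∀ a, β a → BTree) (hn : PolyBdd m fun a => (l a).length)
    (hl : PolyTime m i fun a => .ofList ((l a).map (eb a)))
    (hq : PolyTime (fun p : Σ a, β a => m p.1) (fun p => .cons (eb p.1 p.2) (i p.1))
      (fun p => .bit (q p.1 p.2)))
    (hr : PolyTime (fun p : Σ a, β a => m p.1) (fun p => .cons (eb p.1 p.2) (i p.1))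
      (fun p => r p.1 p.2)) :
    PolyTime m i fun a => .ofList (((l a).filter fun b => q a b).map (r a)) := by
  -- Elements are pushed to the front, so the fold yields the list reversed, and `reverse` follows.
  have key : ∀ a (l' : List (β a)) acc,
      (l'.foldl (fun acc b => if q a b then r a b :: acc else acc) acc) =
        ((l'.filter fun b => q a b).map (r a)).reverse ++ acc := by
    intro a l'
    induction l' with
    | nil => simp
    | cons b l' ih => intro acc; by_cases hb : q a b <;> simp [ih, hb]
  have h₁ : PolyTime m i fun a => .ofList (((l a).filter fun b => q a b).map (r a)).reverse := by
    refine (foldl (γ := fun _ => List BTree) l eb (fun _ l => .ofList l)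
      (fun a acc b => if q a b then r a b :: acc else acc) (fun _ => []) hn hl PolyTime.nil
      ?_).congr fun a => by rw [key]; simp
    have := PolyTime.id (fun p : Σ a, List BTree × β a => m p.1)
      (fun p => .cons (eb p.1 p.2.2) (.cons (.ofList p.2.1) (i p.1)))
    refine ((hq.accum (γ := fun _ => List BTree) fun _ l => .ofList l).ite
      ((hr.accum (γ := fun _ => List BTree) fun _ l => .ofList l).cons this.snd.fst)
      this.snd.fst).congr fun p => ?_
    by_cases hb : q p.1 p.2.2 <;> simp [hb]
  refine (h₁.reverse _ (hn.mono fun a => ?_)).congr fun a => by simp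
  simpa using List.length_filter_le _ _

theorem map (l : ∀ a, List (β a)) (eb : ∀ a, β a → BTree) (r : ∀ a, β a → BTree)
    (hn : PolyBdd m fun a => (l a).length)
    (hl : PolyTime m i fun a => .ofList ((l a).map (eb a)))
    (hr : PolyTime (fun p : Σ a, β a => m p.1) (fun p => .cons (eb p.1 p.2) (i p.1))
      (fun p => r p.1 p.2)) :
    PolyTime m i fun a => .ofList ((l a).map (r a)) :=
  (filterMap l eb (fun _ _ => True) r hn hl ((PolyTime.nil.cons PolyTime.nil).congr fun p => by
    simp) hr).congr fun a => by simp

theorem all (l : ∀ a, List (β a)) (eb : ∀ a, β a → BTree) (q : ∀ a, β a → Prop)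
    (hn : PolyBdd m fun a => (l a).length)
    (hl : PolyTime m i fun a => .ofList ((l a).map (eb a)))
    (hq : PolyTime (fun p : Σ a, β a => m p.1) (fun p => .cons (eb p.1 p.2) (i p.1))
      (fun p => .bit (q p.1 p.2))) :
    PolyTime m i fun a => .bit (∀ b ∈ l a, q a b) := by
  have key : ∀ a (l' : List (β a)) (P : Prop),
      (l'.foldl (fun P b => P ∧ q a b) P) ↔ P ∧ ∀ b ∈ l', q a b := by
    intro a l'
    induction l' with
    | nil => simp
    | cons b l' ih => intro P; simp [ih, and_assoc]
  refine (foldl (γ := fun _ => Prop) l eb (fun _ P => .bit P) (fun a P b => P ∧ q a b)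
    (fun _ => True) hn hl ((PolyTime.nil.cons PolyTime.nil).congr fun p => by simp)
    ?_).congr fun a => BTree.bit_congr (by rw [key]; simp)
  have := PolyTime.id (fun p : Σ a, Prop × β a => m p.1)
    (fun p => .cons (eb p.1 p.2.2) (.cons (.bit p.2.1) (i p.1)))
  exact this.snd.fst.bit_and (hq.accum (γ := fun _ => Prop) fun _ P => .bit P)

theorem any (l : ∀ a, List (β a)) (eb : ∀ a, β a → BTree) (q : ∀ a, β a → Prop)
    (hn : PolyBdd m fun a => (l a).length)
    (hl : PolyTime m i fun a => .ofList ((l a).map (eb a)))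
    (hq : PolyTime (fun p : Σ a, β a => m p.1) (fun p => .cons (eb p.1 p.2) (i p.1))
      (fun p => .bit (q p.1 p.2))) :
    PolyTime m i fun a => .bit (∃ b ∈ l a, q a b) :=
  (all l eb (fun a b => ¬ q a b) hn hl hq.bit_not).bit_not.congr fun a =>
    BTree.bit_congr (by push Not; rfl)

end PolyTime

/-- An optional value as a tree. -/
def BTree.ofOption {δ : Type} (e : δ → BTree) : Option δ → BTree
  | none => nil
  | some d => cons (e d) nil

namespace PolyTime

variable {α : Type} {m : α → ℕ} {i f g : α → BTree} {β γ δ : α → Type}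

/-- The fold goes through the whole list, but evaluates `q` only as long as the accumulator is
`none`. -/
theorem findSome (l : ∀ a, List (β a)) (eb : ∀ a, β a → BTree) (ed : ∀ a, δ a → BTree)
    (q : ∀ a, β a → Option (δ a)) (hn : PolyBdd m fun a => (l a).length)
    (hl : PolyTime m i fun a => .ofList ((l a).map (eb a)))
    (hq : PolyTime (fun p : Σ a, β a => m p.1) (fun p => .cons (eb p.1 p.2) (i p.1))
      (fun p => .ofOption (ed p.1) (q p.1 p.2))) :
    PolyTime m i fun a => .ofOption (ed a) ((l a).findSome? (q a)) := by
  have key : ∀ a (l' : List (β a)) (acc : Option (δ a)),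
      (l'.foldl (fun acc b => acc.or (q a b)) acc) = acc.or (l'.findSome? (q a)) := by
    intro a l'
    induction l' with
    | nil => simp
    | cons b l' ih =>
      intro acc
      cases acc <;> simp only [List.foldl_cons, ih, List.findSome?_cons] <;> cases q a b <;> simp
  refine (foldl (γ := fun a => Option (δ a)) l eb (fun a => .ofOption (ed a))
    (fun a acc b => acc.or (q a b)) (fun _ => none) hn hl PolyTime.nil ?_).congr
    fun a => by rw [key]; simp
  have := PolyTime.id (fun p : Σ a, Option (δ a) × β a => m p.1)
    (fun p => .cons (eb p.1 p.2.2) (.cons (.ofOption (ed p.1) p.2.1) (i p.1)))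
  refine this.snd.fst.cases ((this.snd.fst.reindex Subtype.val).congr ?_)
    (((hq.accum (γ := fun a => Option (δ a)) fun a => .ofOption (ed a)).reindex
      Subtype.val).congr ?_)
  · rintro ⟨⟨a, acc, b⟩, h⟩
    cases acc
    · simp [BTree.ofOption] at h
    · simp
  · rintro ⟨⟨a, acc, b⟩, h⟩
    cases acc
    · simp
    · simp [BTree.ofOption] at h

/-- A fold over the first list; the accumulator holds the unread part of the second list and the
pairs formed so far, in reverse. -/
theorem zip (l : ∀ a, List (β a)) (e₁ e₂ : ∀ a, β a → BTree)
    (hn : PolyBdd m fun a => (l a).length)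
    (h₁ : PolyTime m i fun a => .ofList ((l a).map (e₁ a)))
    (h₂ : PolyTime m i fun a => .ofList ((l a).map (e₂ a))) :
    PolyTime m i fun a => .ofList ((l a).map fun b => .cons (e₁ a b) (e₂ a b)) := by
  have h : PolyTime m i fun a =>
      .ofList ((l a).map fun b => .cons (e₁ a b) (e₂ a b)).reverse := by
    refine (foldIdx (fun a => (l a).map (e₁ a)) (fun a j => .cons
      (.ofList (((l a).drop j).map (e₂ a)))
      (.ofList (((l a).take j).map fun b => .cons (e₁ a b) (e₂ a b)).reverse))
      (by simpa using hn) h₁ ((h₂.cons PolyTime.nil).congr fun a => by simp) ?_).snd.congr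
      fun a => by simp
    have hlt : ∀ p : {p : α × ℕ // p.2 < ((l p.1).map (e₁ p.1)).length},
        p.1.2 < (l p.1.1).length := fun p => by simpa using p.2
    have : PolyTime (fun p : {p : α × ℕ // p.2 < ((l p.1).map (e₁ p.1)).length} => m p.1.1)
        (fun p => .cons (((l p.1.1).map (e₁ p.1.1))[p.1.2]'p.2) (.cons (.cons
          (.ofList (((l p.1.1).drop p.1.2).map (e₂ p.1.1))) (.ofList (((l p.1.1).take p.1.2).map
            fun b => .cons (e₁ p.1.1 b) (e₂ p.1.1 b)).reverse)) (i p.1.1)))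
        (fun p => .cons (e₁ p.1.1 ((l p.1.1)[p.1.2]'(hlt p))) (.cons (.cons
          (.cons (e₂ p.1.1 ((l p.1.1)[p.1.2]'(hlt p)))
            (.ofList (((l p.1.1).drop (p.1.2 + 1)).map (e₂ p.1.1))))
            (.ofList (((l p.1.1).take p.1.2).map
              fun b => .cons (e₁ p.1.1 b) (e₂ p.1.1 b)).reverse)) (i p.1.1))) :=
      (PolyTime.id _ _).congr fun p => by
        rw [List.drop_eq_getElem_cons (hlt p)]
        simp only [List.map_cons, BTree.ofList_cons, List.getElem_map]
    refine (this.snd.fst.fst.snd.cons ((this.fst.cons this.snd.fst.fst.fst).cons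
      this.snd.fst.snd)).congr fun p => ?_
    rw [List.take_succ_eq_append_getElem (hlt p), List.map_append, List.reverse_append]
    rfl
  exact (h.reverse _ (by simpa using hn)).congr fun a => by simp

/-! ### Unary numbers -/

theorem unary_length (L : α → List BTree) (hn : PolyBdd m fun a => (L a).length)
    (hL : PolyTime m i fun a => .ofList (L a)) :
    PolyTime m i fun a => .unary (L a).length :=
  foldIdx L (fun _ j => .unary j) hn hL PolyTime.nil
    (PolyTime.nil.cons (PolyTime.id _ _).snd.fst)

theorem unary_const (k : ℕ) : PolyTime m i fun _ => .unary k := by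
  induction k with
  | zero => exact PolyTime.nil
  | succ k ih => exact PolyTime.nil.cons ih

variable {u v : α → ℕ}

theorem unary_add (hn : PolyBdd m u) (hu : PolyTime m i fun a => .unary (u a))
    (hv : PolyTime m i fun a => .unary (v a)) : PolyTime m i fun a => .unary (v a + u a) :=
  (foldIdx (fun a => List.replicate (u a) .nil) (fun a j => .unary (v a + j))
    (by simpa using hn) hu hv (PolyTime.nil.cons (PolyTime.id _ _).snd.fst)).congr
    fun a => by simp

theorem unary_mul (hn : PolyBdd m u) (hn' : PolyBdd m v)
    (hu : PolyTime m i fun a => .unary (u a)) (hv : PolyTime m i fun a => .unary (v a)) :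
    PolyTime m i fun a => .unary (u a * v a) := by
  refine (foldIdx (fun a => List.replicate (u a) .nil) (fun a j => .unary (j * v a))
    (by simpa using hn) hu (PolyTime.nil.congr fun a => by simp) ?_).congr fun a => by simp
  refine (unary_add (hn'.reindex fun p : {p : α × ℕ //
    p.2 < (List.replicate (u p.1) BTree.nil).length} => p.1.1)
    ((PolyTime.id _ _).snd.snd.comp (hv.reindex fun p : {p : α × ℕ //
      p.2 < (List.replicate (u p.1) BTree.nil).length} => p.1.1))
    (PolyTime.id _ _).snd.fst).congr fun p => ?_
  rw [add_mul, one_mul]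

theorem unary_pow (hn : PolyBdd m u) (hu : PolyTime m i fun a => .unary (u a)) (k : ℕ) :
    PolyTime m i fun a => .unary (u a ^ k) := by
  induction k with
  | zero => exact (unary_const 1).congr fun a => by simp
  | succ k ih => exact (unary_mul (hn.pow k) hn ih hu).congr fun a => by rw [pow_succ]

theorem drop (L : α → List BTree) (hn : PolyBdd m u) (hu : PolyTime m i fun a => .unary (u a))
    (hL : PolyTime m i fun a => .ofList (L a)) :
    PolyTime m i fun a => .ofList ((L a).drop (u a)) :=
  (foldIdx (fun a => List.replicate (u a) .nil) (fun a j => .ofList ((L a).drop j))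
    (by simpa using hn) hu (hL.congr fun a => by simp)
    ((PolyTime.id _ _).snd.fst.tl.congr fun p => by
      cases h : (L p.1.1).drop p.1.2 <;> simp [← List.drop_drop, h])).congr fun a => by simp

/-- The rows of the identity matrix. -/
theorem idMatrix (hn : PolyBdd m u) (hu : PolyTime m i fun a => .unary (u a)) :
    PolyTime m i fun a => .ofList ((List.finRange (u a)).map fun x =>
      .ofList ((List.finRange (u a)).map fun y => .bit (y = x))) := by
  let L : α → List BTree := fun a => List.replicate (u a) .nil
  have hn : PolyBdd m fun a => (L a).length := by simpa [L] using hn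
  -- The matrix of size `j + 1` arises from that of size `j` by prefixing a zero to each row and
  -- adding a first row `1, 0, …, 0`; the unary `j` in the accumulator supplies these zeros.
  refine (foldIdx L (fun _ j => .cons (.unary j) (.ofList ((List.finRange j).map fun x =>
    .ofList ((List.finRange j).map fun y => .bit (y = x))))) hn hu
    (PolyTime.nil.cons PolyTime.nil) ?_).snd.congr fun a => by
      rw [show (L a).length = u a from List.length_replicate ..]
  have h := PolyTime.id (fun p : {p : α × ℕ // p.2 < (L p.1).length} => m p.1.1)
    (fun p => .cons ((L p.1.1)[p.1.2]'p.2) (.cons (.cons (.unary p.1.2)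
      (.ofList ((List.finRange p.1.2).map fun x =>
        .ofList ((List.finRange p.1.2).map fun y => .bit (y = x))))) (i p.1.1)))
  refine ((PolyTime.nil.cons h.snd.fst.fst).cons (((PolyTime.nil.cons PolyTime.nil).cons
    h.snd.fst.fst).cons (map (fun p => List.finRange p.1.2)
      (fun p x => .ofList ((List.finRange p.1.2).map fun y => .bit (y = x)))
      (fun p x => .cons .nil (.ofList ((List.finRange p.1.2).map fun y => .bit (y = x))))
      ((hn.reindex fun p : {p : α × ℕ // p.2 < (L p.1).length} => p.1.1).mono fun p => by simpa using p.2.le) h.snd.fst.snd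
      (PolyTime.nil.cons (PolyTime.id _ _).fst)))).congr fun p => ?_
  simp [List.finRange_succ, List.replicate_succ, Function.comp_def, BTree.unary, Fin.succ_ne_zero,
    (Fin.succ_ne_zero _).symm, List.map_const']

end PolyTime

/-! ### Enumeration by a loop -/

/-- Delay accounting: the first `K` steps contain all of `w` and at least `E` steps of what follows.
-/
theorem Trace.le_length_outputs_take_append {w u : Trace} {D E K : ℕ} (hw : w.length ≤ D)
    (hK : D + E ≤ K) : (Trace.outputs w).length + (Trace.outputs (u.take E)).length ≤
      (Trace.outputs ((w ++ u).take K)).length := by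
  rw [List.take_append, List.take_of_length_le (l := w) (by omega),
    Trace.outputs_append, List.length_append]
  exact Nat.add_le_add_left (Trace.length_outputs_take_mono u (by omega)) _

/-- A sequence of values can be enumerated in incremental polynomial time if each of them can be
found in polynomial time from what is known when the previous one has been output. -/
theorem PolyTime.exists_enumeration {α : Type} {m N : α → ℕ} {i : α → BTree}
    (st v r : α → ℕ → BTree) (hst : ∀ a j, j < N a → st a j = .cons (v a j) (r a j))
    (hend : ∀ a, st a (N a) = .nil) (h₀ : PolyTime m i fun a => st a 0)
    (h : PolyTime (fun p : {p : α × ℕ // p.2 < N p.1} => m p.1.1 + p.1.2)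
      (fun p => r p.1.1 p.1.2) (fun p => st p.1.1 (p.1.2 + 1))) :
    ∃ (c : Prog) (d : ℕ), ∀ a, ∃ t : Trace, (∃ τ, Exec c (initStore (i a)) t τ) ∧
      t.outputs = (List.range (N a)).map (v a) ∧ t.length ≤ (m a + N a + 2) ^ d ∧
      ∀ s, 1 ≤ s → s ≤ N a →
        s ≤ (Trace.outputs (t.take ((m a + s + 2) ^ d))).length := by
  obtain ⟨c₀, T₀, ⟨d₀, hT₀⟩, hc₀⟩ := h₀
  obtain ⟨c, T, ⟨d, hT⟩, hc⟩ := h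
  -- Each value is emitted before the next state is computed, so the time until an output does not
  -- include the work for its successor.
  set w : Prog := .while 0 (.seq (.hd 1 0) (.seq (.emit 1) (.seq (.tl 0 0) c))) with hw
  -- The `4` counts the loop test, `hd`, `emit` and `tl` of one round.
  have key : ∀ a k j, k + j = N a → ∀ σ : Store, σ 0 = st a j →
      ∃ t τ, Exec w σ t τ ∧ t.outputs = (List.range' j k).map (v a) ∧
        t.length ≤ k * ((m a + N a + 2) ^ d + 4) + 1 ∧
        ∀ s, 1 ≤ s → s ≤ k →
          s ≤ (Trace.outputs (t.take (s * ((m a + (j + s) + 2) ^ d + 4)))).length := by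
    intro a k
    induction k with
    | zero =>
      intro j hj σ h0
      obtain rfl : j = N a := by omega
      exact ⟨_, _, Exec.whileFalse (by rw [h0, hend]), by simp, by simp, by omega⟩
    | succ k ih =>
      intro j hj σ h0
      have hlt : j < N a := by omega
      rw [hst a j hlt] at h0
      obtain ⟨t, τ, e₁, o₁, l₁, r₁⟩ := hc ⟨(a, j), hlt⟩ (Function.update
        (Function.update σ 1 (σ 0).hd) 0 (Function.update σ 1 (σ 0).hd 0).tl) (by simp [h0])
      obtain ⟨u, ρ, e₂, o₂, l₂, g₂⟩ := ih (j + 1) (by omega) τ r₁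
      have hT' := hT ⟨(a, j), hlt⟩
      simp only at hT'
      have hmono : ∀ x, j ≤ x → t.length ≤ (m a + x + 2) ^ d := fun x hx =>
        l₁.trans (hT'.trans (Nat.pow_le_pow_left (by omega) d))
      refine ⟨_, _, Exec.whileTrue (by simp [h0]) ((Exec.hd 1 0 σ).seq ((Exec.emit 1 _).seq
        ((Exec.tl 0 0 _).seq e₁))) e₂, ?_, ?_, ?_⟩
      · simp [o₁, o₂, h0, List.range'_succ]
      · have := hmono (N a) hlt.le
        simp only [List.length_append, List.length_cons, List.length_nil]
        rw [add_mul]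
        omega
      · intro s hs hsk
        obtain ⟨s, rfl⟩ : ∃ s', s = s' + 1 := ⟨s - 1, by omega⟩
        rw [← List.cons_append]
        refine le_trans ?_ (Trace.le_length_outputs_take_append
          (D := (m a + (j + (s + 1)) + 2) ^ d + 4)
          (E := s * ((m a + (j + (s + 1)) + 2) ^ d + 4)) ?_ (by rw [add_mul]; omega))
        · rcases Nat.eq_zero_or_pos s with rfl | hpos
          · simp [o₁]
          · have := g₂ s hpos (by omega)
            rw [add_assoc j, add_comm 1 s] at this
            simp only [o₁, List.singleton_append, Trace.outputs_cons_none,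
              Trace.outputs_cons_some, List.length_cons, List.length_nil]
            omega
        · have := hmono (j + (s + 1)) (by omega)
          simp only [List.length_append, List.length_cons, List.length_nil]
          omega
  -- One exponent serves both claims: the total time with `p.2 = N a`, the `s`-th output with `p.2 =
  -- s`.
  have hb : PolyBdd (fun p : α × ℕ => m p.1 + p.2)
      (fun p => (m p.1 + 2) ^ d₀ + p.2 * ((m p.1 + p.2 + 2) ^ d + 4) + 1) := by
    have h1 : PolyBdd (fun p : α × ℕ => m p.1 + p.2) (fun p => m p.1) :=
      (PolyBdd.self _).mono fun p => by simp
    have h2 : PolyBdd (fun p : α × ℕ => m p.1 + p.2) (fun p => p.2) :=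
      (PolyBdd.self _).mono fun p => by simp
    exact (((h1.add (PolyBdd.const _ 2)).pow d₀).add (h2.mul ((((PolyBdd.self _).add
      (PolyBdd.const _ 2)).pow d).add (PolyBdd.const _ 4)))).add (PolyBdd.const _ 1)
  obtain ⟨e, he⟩ := hb
  refine ⟨.seq c₀ w, e, fun a => ?_⟩
  obtain ⟨t, τ, e₁, o₁, l₁, r₁⟩ := hc₀ a (initStore (i a)) rfl
  obtain ⟨u, ρ, e₂, o₂, l₂, g₂⟩ := key a (N a) 0 rfl τ r₁
  have ht := l₁.trans (hT₀ a)
  refine ⟨_, ⟨_, e₁.seq e₂⟩, ?_, ?_, fun s hs hsN => ?_⟩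
  · rw [Trace.outputs_append, o₁, o₂, List.range_eq_range']
    rfl
  · refine le_trans ?_ (he (a, N a))
    rw [List.length_append]
    simp only
    omega
  · have := g₂ s hs hsN
    rw [zero_add] at this
    have h3 := Trace.le_length_outputs_take_append (u := u)
      (E := s * ((m a + s + 2) ^ d + 4)) ht ((Nat.le_succ _).trans (he (a, s)))
    rw [o₁, List.length_nil, zero_add] at h3
    exact this.trans h3

/-! ### Enumerated solutions -/

theorem encodeVertexSet_eq {n : ℕ} (U : Finset (Fin n)) :
    encodeVertexSet U = .ofList ((List.finRange n).map fun x => .bit (x ∈ U)) := by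
  rw [encodeVertexSet, List.ofFn_eq_map]

theorem encodeGraph_eq {n : ℕ} (G : SimpleGraph (Fin n)) :
    encodeGraph G = .ofList ((List.finRange n).map fun x =>
      .ofList ((List.finRange n).map fun y => .bit (G.Adj x y))) := by
  simp only [encodeGraph, List.ofFn_eq_map]

theorem encodeVertexSet_injective {n : ℕ} :
    Function.Injective (encodeVertexSet : Finset (Fin n) → BTree) := by
  intro U W h
  have h' := List.ofFn_injective (BTree.ofList_injective h)
  ext x
  exact BTree.bit_inj.1 (congrFun h' x)

/-- The encoding of vertex sets is injective, so the outputs come from a duplicate-free list of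
sets, and their number is the number of solutions. -/
theorem EnumeratesOn.exists_list {P : GraphClass} {c : Prog} {n : ℕ} {G : SimpleGraph (Fin n)}
    {t : Trace} (h : EnumeratesOn P c G t) : ∃ l : List (Finset (Fin n)), l.Nodup ∧
      (∀ U, U ∈ l ↔ U ∈ maxConnectedPSets P G) ∧ t.outputs = l.map encodeVertexSet ∧
      l.length = (maxConnectedPSets P G).ncard := by
  obtain ⟨-, hnd, hmem⟩ := h
  have : ∃ l : List (Finset (Fin n)), l.map encodeVertexSet = t.outputs := by
    have : t.outputs ∈ Set.range (List.map (encodeVertexSet (n := n))) := by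
      rw [Set.range_list_map]
      intro v hv
      obtain ⟨U, -, hU⟩ := (hmem v).1 hv
      exact ⟨U, hU⟩
    exact this
  obtain ⟨l, hl⟩ := this
  rw [← hl] at hnd hmem
  have hlnd := hnd.of_map
  have hiff : ∀ U, U ∈ l ↔ U ∈ maxConnectedPSets P G := by
    intro U
    have := hmem (encodeVertexSet U)
    simpa [encodeVertexSet_injective.eq_iff] using this
  refine ⟨l, hlnd, hiff, hl.symm, ?_⟩
  have : maxConnectedPSets P G = ↑l.toFinset := by ext U; simp [hiff]
  rw [this, Set.ncard_coe_finset, List.toFinset_card_of_nodup hlnd]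

theorem EnumeratesOn.length_outputs {P : GraphClass} {c : Prog} {n : ℕ}
    {G : SimpleGraph (Fin n)} {t : Trace} (h : EnumeratesOn P c G t) :
    t.outputs.length = (maxConnectedPSets P G).ncard := by
  obtain ⟨l, -, -, h₁, h₂⟩ := h.exists_list
  rw [h₁, List.length_map, h₂]

/-! ### From incremental polynomial time to polynomial total time -/

theorem SolvableInIncrementalPolyTime.solvableInPolyTotalTime {P : GraphClass}
    (h : SolvableInIncrementalPolyTime P) : SolvableInPolyTotalTime P := by
  obtain ⟨c, p, h⟩ := h
  obtain ⟨d, hd⟩ := p.exists_eval_lt_pow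
  choose tr htr hinc using h
  let N : (Σ n, SimpleGraph (Fin n)) → ℕ := fun a => (maxConnectedPSets P a.2).ncard
  let m : (Σ n, SimpleGraph (Fin n)) → ℕ := fun a => a.1 + N a
  -- This is `(n + (s + 1) + 2) ^ d`, enough time for solution number `s + 1` if it exists.
  let B : (Σ n, SimpleGraph (Fin n)) → ℕ → ℕ := fun a s => (s + a.1 + 3) ^ d
  let outs : (Σ n, SimpleGraph (Fin n)) → ℕ → List BTree := fun a s =>
    (Trace.outputs ((tr a.1 a.2).take (B a s))).reverse
  -- The left subtree controls the loop: it is `nil` exactly if the run with clock `B a s` gave at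
  -- most `s` outputs, which first happens at `s = N a`.
  let st : (Σ n, SimpleGraph (Fin n)) → ℕ → BTree := fun a s =>
    .cons (.ofList ((outs a s).drop s)) (.cons (.unary s) (.cons (.ofList (outs a s))
      (encodeGraph a.2)))
  have hlen : ∀ a s, (outs a s).length ≤ N a := by
    intro a s
    simp only [outs, List.length_reverse, N]
    rw [← (htr a.1 a.2).length_outputs]
    exact (Trace.outputs_take_prefix _ _).length_le
  have hge : ∀ a s s', 1 ≤ s → s ≤ N a → s ≤ s' + 1 → s ≤ (outs a s').length := by
    intro a s s' h1 h2 h3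
    simp only [outs, List.length_reverse]
    refine (hinc a.1 a.2 s h1 h2).trans (Trace.length_outputs_take_mono _ ?_)
    exact (hd a.1 s).le.trans (Nat.pow_le_pow_left (by omega) d)
  have hst : PolyTime (fun p : {p : (Σ n, SimpleGraph (Fin n)) × ℕ // p.2 ≤ N p.1} => m p.1.1)
      (fun p => .cons (.unary p.1.2) (encodeGraph p.1.1.2)) (fun p => st p.1.1 p.1.2) := by
    have hid := PolyTime.id
      (fun p : {p : (Σ n, SimpleGraph (Fin n)) × ℕ // p.2 ≤ N p.1} => m p.1.1)
      (fun p => .cons (.unary p.1.2) (encodeGraph p.1.1.2))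
    have hs : PolyBdd (fun p : {p : (Σ n, SimpleGraph (Fin n)) × ℕ // p.2 ≤ N p.1} => m p.1.1)
        (fun p => p.1.2) := (PolyBdd.self _).mono fun p => p.2.trans (by simp [m])
    have hn : PolyBdd (fun p : {p : (Σ n, SimpleGraph (Fin n)) × ℕ // p.2 ≤ N p.1} => m p.1.1)
        (fun p => p.1.1.1) := (PolyBdd.self _).mono fun p => by simp [m]
    have hun := (PolyTime.unary_length _ (by simpa using hn) hid.snd).congr
      (f := fun p => .unary p.1.1.1) fun p => by simp
    have hB := PolyTime.unary_pow ((hs.add hn).add (PolyBdd.const _ 3))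
      (PolyTime.unary_add (PolyBdd.const _ 3) (PolyTime.unary_const 3)
        (PolyTime.unary_add hn hun hid.fst)) d
    have houts := (PolyTime.simulate c (v := fun p => encodeGraph p.1.1.2)
      (tr := fun p => tr p.1.1.1 p.1.1.2) (fun p => (htr _ _).1)
      (((hs.add hn).add (PolyBdd.const _ 3)).pow d) hid.snd hB).fst
    exact (PolyTime.drop (fun p => outs p.1.1 p.1.2) hs hid.fst houts).cons
      (hid.fst.cons (houts.cons hid.snd))
  have hfin : PolyTime m (fun a => encodeGraph a.2) (fun a => .ofList (outs a (N a))) := by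
    have h₀ : PolyTime m (fun a => encodeGraph a.2) (fun a => st a 0) :=
      (PolyTime.nil.cons (PolyTime.id _ _)).comp
        (hst.reindex (β := Σ n, SimpleGraph (Fin n)) fun a => ⟨(a, 0), by simp⟩)
    refine (h₀.comp (PolyTime.loop (N := N) st ((PolyBdd.self _).mono fun a => by simp [m])
      ?_ ?_ ?_)).snd.snd.fst
    · intro a j hj
      have := hge a (j + 1) j (by omega) hj le_rfl
      simp only [st, BTree.hd_cons, ne_eq, BTree.ofList_eq_nil, List.drop_eq_nil_iff]
      omega
    · intro a
      simp only [st, BTree.hd_cons, BTree.ofList_eq_nil, List.drop_eq_nil_iff]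
      exact hlen a _
    · have hid := PolyTime.id
        (fun p : {p : (Σ n, SimpleGraph (Fin n)) × ℕ // p.2 < N p.1} => m p.1.1)
        (fun p => st p.1.1 p.1.2)
      exact ((PolyTime.nil.cons hid.snd.fst).cons hid.snd.snd.snd).comp
        (hst.reindex (β := {p : (Σ n, SimpleGraph (Fin n)) × ℕ // p.2 < N p.1})
          fun p => ⟨(p.1.1, p.1.2 + 1), p.2⟩)
  have hfull : ∀ a, outs a (N a) = (tr a.1 a.2).outputs.reverse := by
    intro a
    have h1 := (Trace.outputs_take_prefix (tr a.1 a.2) (B a (N a)))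
    simp only [outs]
    rw [h1.eq_of_length]
    have h2 : (outs a (N a)).length = N a := by
      refine le_antisymm (hlen a _) ?_
      rcases Nat.eq_zero_or_pos (N a) with h0 | h0
      · omega
      · exact hge a (N a) (N a) h0 le_rfl (by omega)
    rw [(htr a.1 a.2).length_outputs]
    simpa [outs] using h2
  have hlenN : ∀ a, (outs a (N a)).length = N a := fun a => by
    rw [hfull, List.length_reverse, (htr a.1 a.2).length_outputs]
  -- Nothing is emitted during the search. The complete list is emitted afterwards, in reverse
  -- order, the state after `j` outputs being the list without its first `j` elements.
  obtain ⟨c', e, hc'⟩ := PolyTime.exists_enumeration (N := N)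
    (fun a j => .ofList ((outs a (N a)).drop j)) (fun a j => (outs a (N a)).getD j .nil)
    (fun a j => .ofList ((outs a (N a)).drop (j + 1)))
    (fun a j hj => by
      rw [List.drop_eq_getElem_cons (by rw [hlenN]; exact hj), BTree.ofList_cons,
        List.getD_eq_getElem])
    (fun a => by simp [hlenN]) (hfin.congr fun a => by simp) (PolyTime.id _ _)
  -- The number of solutions enters twice: once through `m = n + N`, once as the number of rounds.
  refine ⟨c', (.X 0 + .X 1 + .X 1 + .C 2) ^ e, fun n G => ?_⟩
  obtain ⟨t, ht, ho, hl, -⟩ := hc' ⟨n, G⟩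
  have hout : t.outputs = (tr n G).outputs.reverse := by
    rw [ho, ← hfull ⟨n, G⟩]
    refine List.ext_getElem (by simp [hlenN]) fun k h1 h2 => ?_
    simp [List.getElem?_eq_getElem h2]
  refine ⟨t, ⟨ht, ?_, fun v => ?_⟩, by simpa [m, N] using hl⟩
  · rw [hout]; exact List.nodup_reverse.2 (htr n G).2.1
  · rw [hout, List.mem_reverse]; exact (htr n G).2.2 v

/-! ### Connected sets of a hereditary class -/

namespace IsConnectedPSet

variable {P : GraphClass} {n : ℕ} {G : SimpleGraph (Fin n)} {C T U W X : Finset (Fin n)}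

theorem nonempty (h : IsConnectedPSet P G U) : U.Nonempty := by
  obtain ⟨x⟩ := h.1.nonempty
  exact ⟨x.1, x.2⟩

theorem of_subset (hP : P.Hereditary) (hU : IsConnectedPSet P G U) (hW : W ⊆ U)
    (hc : (G.induce (W : Set (Fin n))).Connected) : IsConnectedPSet P G W := by
  refine ⟨hc, ?_⟩
  obtain ⟨x⟩ := hc.nonempty
  refine P.iso_closed ⟨?_⟩ (hP _ hU.2 {y : (U : Set (Fin n)) | y.1 ∈ W} ⟨⟨x.1, hW x.2⟩, x.2⟩)
  exact {
    toFun := fun y => ⟨y.1.1, y.2⟩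
    invFun := fun y => ⟨⟨y.1, hW y.2⟩, y.2⟩
    left_inv := fun _ => rfl
    right_inv := fun _ => rfl
    map_rel_iff' := Iff.rfl }

/-- The class contains a graph with a vertex, hence by heredity a one-vertex graph, and all of these
are isomorphic. -/
theorem singleton (hP : P.Hereditary) (G : SimpleGraph (Fin n)) (v : Fin n) :
    IsConnectedPSet P G {v} := by
  obtain ⟨k, H, hk, hH⟩ := P.nonempty
  have h := hP H hH {⟨0, hk⟩} ⟨_, rfl⟩
  have : Unique ((({v} : Finset (Fin n)) : Set (Fin n))) :=
    ⟨⟨⟨v, by simp⟩⟩, fun x => Subtype.ext (by simpa using x.2)⟩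
  constructor
  · exact (SimpleGraph.connected_iff _).2
      ⟨SimpleGraph.Preconnected.of_subsingleton, inferInstance⟩
  · refine P.iso_closed ⟨⟨Equiv.ofUnique _ _, ?_⟩⟩ h
    intro a b
    rw [Subsingleton.elim a b]
    simp

/-- Meeting connected sets have a connected union; the common superset `U` is what puts the union
into `P`, by heredity. -/
theorem union (hP : P.Hereditary) (hX : IsConnectedPSet P G X) (hW : IsConnectedPSet P G W)
    (hne : (X ∩ W).Nonempty) (hU : IsConnectedPSet P G U) (hXU : X ⊆ U) (hWU : W ⊆ U) :
    IsConnectedPSet P G (X ∪ W) := by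
  refine hU.of_subset hP (Finset.union_subset hXU hWU) ?_
  rw [Finset.coe_union]
  refine SimpleGraph.induce_union_connected hX.1.preconnected hW.1.preconnected ?_
  rw [← Finset.coe_inter]
  exact_mod_cast hne

/-- A walk in `G[T]` from `C` to `T \ C` has an edge that leaves `C`; its outer end can be added. -/
theorem exists_insert (hP : P.Hereditary) (hT : IsConnectedPSet P G T)
    (hC : IsConnectedPSet P G C) (hCT : C ⊂ T) :
    ∃ v ∈ T, v ∉ C ∧ IsConnectedPSet P G (insert v C) := by
  obtain ⟨u, hu⟩ := hC.nonempty
  obtain ⟨w, hwT, hwC⟩ := Finset.exists_of_ssubset hCT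
  obtain ⟨p⟩ := hT.1.preconnected ⟨u, hCT.subset hu⟩ ⟨w, hwT⟩
  obtain ⟨d, -, h₁, h₂⟩ := p.exists_boundary_dart {x | x.1 ∈ C} hu hwC
  refine ⟨d.snd.1, d.snd.2, h₂, hT.of_subset hP
    (Finset.insert_subset d.snd.2 hCT.subset) ?_⟩
  have : ((insert d.snd.1 C : Finset (Fin n)) : Set (Fin n)) = (C : Set (Fin n)) ∪ {d.snd.1} := by
    rw [Finset.coe_insert, Set.union_singleton]
  rw [this]
  exact SimpleGraph.connected_induce_union hC.1.preconnected
    SimpleGraph.Preconnected.of_subsingleton h₁ rfl d.adj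

theorem exists_maximal (h : IsConnectedPSet P G X) (hX : X ⊆ U) :
    ∃ W, X ⊆ W ∧ Maximal (fun W => IsConnectedPSet P G W ∧ W ⊆ U) W :=
  (Set.toFinite _).exists_le_maximal (s := {W | IsConnectedPSet P G W ∧ W ⊆ U}) ⟨h, hX⟩

end IsConnectedPSet

theorem eq_of_mem_maxConnectedPSets {P : GraphClass} {n : ℕ} {G : SimpleGraph (Fin n)}
    {U W : Finset (Fin n)} (hU : U ∈ maxConnectedPSets P G) (hW : IsConnectedPSet P G W)
    (h : U ⊆ W) : U = W :=
  (show Maximal (IsConnectedPSet P G) U from hU).eq_of_le hW h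

/-! ### Induced subgraphs on an initial segment of the natural numbers -/

section Restrict

variable {P : GraphClass} {n : ℕ} {G : SimpleGraph (Fin n)} {K : Finset (Fin n)}

/-- The elements of `K` in increasing order. -/
def vertexList (K : Finset (Fin n)) : List (Fin n) := (List.finRange n).filter fun x => x ∈ K

theorem mem_vertexList {x : Fin n} : x ∈ vertexList K ↔ x ∈ K := by simp [vertexList]

theorem nodup_vertexList (K : Finset (Fin n)) : (vertexList K).Nodup :=
  (List.nodup_finRange n).filter _

theorem length_vertexList_le (K : Finset (Fin n)) : (vertexList K).length ≤ n :=
  (List.length_filter_le _ _).trans (by simp)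

/-- The numbering of the elements of `K` in increasing order. -/
def vertexEmb (K : Finset (Fin n)) : Fin (vertexList K).length ↪ Fin n :=
  ⟨(vertexList K).get, (nodup_vertexList K).injective_get⟩

theorem map_univ_vertexEmb (K : Finset (Fin n)) : Finset.univ.map (vertexEmb K) = K := by
  ext x
  rw [← mem_vertexList (K := K), List.mem_iff_get]
  simp [vertexEmb]

/-- `G[K]` with its vertices numbered in increasing order. -/
def restrict (G : SimpleGraph (Fin n)) (K : Finset (Fin n)) :
    SimpleGraph (Fin (vertexList K).length) :=
  G.comap (vertexEmb K)

/-- Programs accept only graphs on `Fin k`. Closure under isomorphism translates answers about the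
renumbered graph back to `G`. -/
theorem isConnectedPSet_restrict {W : Finset (Fin (vertexList K).length)} :
    IsConnectedPSet P (restrict G K) W ↔ IsConnectedPSet P G (W.map (vertexEmb K)) := by
  have e : (restrict G K).induce (W : Set _) ≃g
      G.induce ((W.map (vertexEmb K) : Finset (Fin n)) : Set (Fin n)) :=
    { toEquiv := (Equiv.Set.image _ (W : Set _) (vertexEmb K).injective).trans
        (Equiv.setCongr (Finset.coe_map _ _).symm)
      map_rel_iff' := Iff.rfl }
  exact and_congr e.connected_iff ⟨P.iso_closed ⟨e⟩, P.iso_closed ⟨e.symm⟩⟩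

theorem map_vertexEmb_subset (W : Finset (Fin (vertexList K).length)) :
    W.map (vertexEmb K) ⊆ K := by
  conv_rhs => rw [← map_univ_vertexEmb K]
  exact Finset.map_subset_map.2 (Finset.subset_univ W)

theorem exists_map_vertexEmb {X : Finset (Fin n)} (hX : X ⊆ K) :
    ∃ W : Finset (Fin (vertexList K).length), W.map (vertexEmb K) = X := by
  rw [← map_univ_vertexEmb K, Finset.subset_map_iff] at hX
  obtain ⟨W, -, hW⟩ := hX
  exact ⟨W, hW.symm⟩

/-- Every connected set of the class inside `K` is covered by a maximal one. -/
theorem exists_mem_maxConnectedPSets_restrict {X : Finset (Fin n)} (h : IsConnectedPSet P G X)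
    (hX : X ⊆ K) : ∃ W ∈ maxConnectedPSets P (restrict G K), X ⊆ W.map (vertexEmb K) := by
  obtain ⟨X, rfl⟩ := exists_map_vertexEmb hX
  obtain ⟨W, hW, hmax⟩ := (isConnectedPSet_restrict.2 h).exists_maximal (Finset.subset_univ _)
  exact ⟨W, ⟨hmax.prop.1, fun Y hY hWY => hmax.2 ⟨hY, Finset.subset_univ _⟩ hWY⟩,
    Finset.map_subset_map.2 hW⟩

/-- Two solutions of `G[K]` that meet and lie in a common connected set of the class are equal. -/
theorem eq_of_mem_maxConnectedPSets_restrict (hP : P.Hereditary)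
    {W₁ W₂ : Finset (Fin (vertexList K).length)}
    (h₁ : W₁ ∈ maxConnectedPSets P (restrict G K)) (h₂ : W₂ ∈ maxConnectedPSets P (restrict G K))
    {v : Fin n} (hv₁ : v ∈ W₁.map (vertexEmb K)) (hv₂ : v ∈ W₂.map (vertexEmb K))
    {U : Finset (Fin n)} (hU : IsConnectedPSet P G U) (hU₁ : W₁.map (vertexEmb K) ⊆ U)
    (hU₂ : W₂.map (vertexEmb K) ⊆ U) : W₁ = W₂ := by
  have h : IsConnectedPSet P (restrict G K) (W₁ ∪ W₂) := by
    rw [isConnectedPSet_restrict, Finset.map_union]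
    exact (isConnectedPSet_restrict.1 h₁.prop).union hP (isConnectedPSet_restrict.1 h₂.prop)
      ⟨v, Finset.mem_inter.2 ⟨hv₁, hv₂⟩⟩ hU hU₁ hU₂
  exact (eq_of_mem_maxConnectedPSets h₁ h Finset.subset_union_left).trans
    (eq_of_mem_maxConnectedPSets h₂ h Finset.subset_union_right).symm

end Restrict

/-! ### Uncovered sets: the counting bound and the completeness criterion -/

section Uncovered

variable {P : GraphClass} {n : ℕ} {G : SimpleGraph (Fin n)} {L : List (Finset (Fin n))}
  {K K' U : Finset (Fin n)} {v : Fin n}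

/-- Some connected `P` set inside `K` is not contained in a member of `L`. -/
def HasUncovered (P : GraphClass) (G : SimpleGraph (Fin n)) (L : List (Finset (Fin n)))
    (K : Finset (Fin n)) : Prop :=
  ∃ X, IsConnectedPSet P G X ∧ X ⊆ K ∧ ∀ U ∈ L, ¬ X ⊆ U

theorem HasUncovered.mono (h : HasUncovered P G L K) (hK : K ⊆ K') : HasUncovered P G L K' :=
  let ⟨X, h₁, h₂, h₃⟩ := h
  ⟨X, h₁, h₂.trans hK, h₃⟩

/-- If all connected sets of the class inside `K ⊆ U ∪ {v}` are covered by `L`, then `G[K]` has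
few solutions. -/
theorem ncard_maxConnectedPSets_restrict_le (hP : P.Hereditary)
    (hL : ∀ U ∈ L, U = ∅ ∨ IsConnectedPSet P G U) (hU : U ∈ L) (hK : K ⊆ insert v U)
    (h : ¬ HasUncovered P G L K) :
    (maxConnectedPSets P (restrict G K)).ncard ≤ L.length + n := by
  classical
  have hcov : ∀ W ∈ maxConnectedPSets P (restrict G K),
      ∃ U' ∈ L, W.map (vertexEmb K) ⊆ U' := by
    intro W hW
    by_contra! hcon
    exact h ⟨_, isConnectedPSet_restrict.1 hW.prop, map_vertexEmb_subset W, hcon⟩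
  have hne : ∀ W ∈ maxConnectedPSets P (restrict G K), ∃ x, x ∈ W.map (vertexEmb K) :=
    fun W hW => (isConnectedPSet_restrict.1 hW.prop).nonempty
  have hconn : ∀ U' ∈ L, ∀ x ∈ U', IsConnectedPSet P G U' := by
    intro U' hU' x hx
    rcases hL U' hU' with rfl | h'
    · simp at hx
    · exact h'
  have : Nonempty (Fin n) := ⟨v⟩
  choose! cov hcovL hcov using hcov
  choose! vert hvert using hne
  -- A solution through `v` goes to a member of `L` that covers it; one avoiding `v` lies in `U` and
  -- goes to one of its vertices. In both cases equal images force two solutions to meet inside a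
  -- common connected `P` set.
  let F : Finset (Fin (vertexList K).length) → Finset (Fin n) ⊕ Fin n := fun W =>
    if v ∈ W.map (vertexEmb K) then .inl (cov W) else .inr (vert W)
  have hF : Set.InjOn F (maxConnectedPSets P (restrict G K)) := by
    intro W₁ h₁ W₂ h₂ heq
    simp only [F] at heq
    split_ifs at heq with g₁ g₂ g₂
    · have heq := Sum.inl_injective heq
      exact eq_of_mem_maxConnectedPSets_restrict hP h₁ h₂ g₁ g₂
        (hconn _ (hcovL _ h₁) _ (hcov _ h₁ g₁)) (hcov _ h₁) (heq ▸ hcov _ h₂)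
    · have heq := Sum.inr_injective heq
      have hsub : ∀ W : Finset (Fin (vertexList K).length), v ∉ W.map (vertexEmb K) →
          W.map (vertexEmb K) ⊆ U := fun W hW =>
        (Finset.subset_insert_iff_of_notMem hW).1 ((map_vertexEmb_subset W).trans hK)
      exact eq_of_mem_maxConnectedPSets_restrict hP h₁ h₂ (hvert _ h₁) (heq ▸ hvert _ h₂)
        (hconn _ hU _ (hsub _ g₁ (hvert _ h₁))) (hsub _ g₁) (hsub _ g₂)
  have hcard : (maxConnectedPSets P (restrict G K)).ncard ≤
      ((L.toFinset.disjSum Finset.univ : Finset (Finset (Fin n) ⊕ Fin n)) :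
        Set (Finset (Fin n) ⊕ Fin n)).ncard := by
    refine Set.ncard_le_ncard_of_injOn F (fun W hW => ?_) hF (Finset.finite_toSet _)
    simp only [F]
    split_ifs
    · simpa using hcovL W hW
    · simp
  refine hcard.trans ?_
  rw [Set.ncard_coe_finset, Finset.card_disjSum, Finset.card_univ, Fintype.card_fin]
  exact Nat.add_le_add_right (List.toFinset_card_le L) n

/-- If `L` leaves nothing uncovered one vertex away from its members, it is complete. -/
theorem mem_of_forall_not_hasUncovered (hP : P.Hereditary)
    (hL : ∀ U ∈ L, U = ∅ ∨ IsConnectedPSet P G U) (hL₀ : ∅ ∈ L)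
    (h : ∀ U ∈ L, ∀ v, ¬ HasUncovered P G L (insert v U)) {T : Finset (Fin n)}
    (hT : T ∈ maxConnectedPSets P G) : T ∈ L := by
  have hcov : ∀ U ∈ L, ∀ v X, IsConnectedPSet P G X → X ⊆ insert v U → ∃ U' ∈ L, X ⊆ U' := by
    intro U hU v X hX hXU
    by_contra! hcon
    exact h U hU v ⟨X, hX, hXU, hcon⟩
  obtain ⟨v, hv⟩ := hT.prop.nonempty
  -- `T` is approached through connected `P` sets `C` of growing size. If `U ∈ L` covers `C`, then
  -- the next one lies in `insert w U`, so it is covered as well; the start needs `∅ ∈ L`.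
  have key : ∀ k, k + 1 ≤ T.card → ∃ C, IsConnectedPSet P G C ∧ C ⊆ T ∧ C.card = k + 1 ∧
      ∃ U ∈ L, C ⊆ U := by
    intro k
    induction k with
    | zero =>
      intro _
      exact ⟨{v}, .singleton hP G v, by simpa using hv, by simp,
        hcov ∅ hL₀ v {v} (.singleton hP G v) (by simp)⟩
    | succ k ih =>
      intro hk
      obtain ⟨C, hC, hCT, hcard, U, hU, hCU⟩ := ih (by omega)
      obtain ⟨w, hwT, hwC, hw⟩ := hT.prop.exists_insert hP hC
        (hCT.ssubset_of_ne (by rintro rfl; omega))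
      exact ⟨insert w C, hw, Finset.insert_subset hwT hCT,
        by rw [Finset.card_insert_of_notMem hwC, hcard],
        hcov U hU w _ hw (Finset.insert_subset_insert w hCU)⟩
  have hpos := Finset.card_pos.2 ⟨v, hv⟩
  obtain ⟨C, -, hCT, hcard, U, hU, hCU⟩ := key (T.card - 1) (by omega)
  obtain rfl := Finset.eq_of_subset_of_card_le hCT (by omega)
  rcases hL U hU with rfl | hU'
  · simp at hCU; simp [hCU] at hv
  · rwa [eq_of_mem_maxConnectedPSets hT hU' hCU]

end Uncovered

/-! ### The enumeration step -/

/-- A program that enumerates the solutions in polynomial total time, with its computations. -/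
structure Enumerator (P : GraphClass) where
  prog : Prog
  deg : ℕ
  trace : ∀ {n : ℕ}, SimpleGraph (Fin n) → Trace
  enumerates : ∀ {n : ℕ} (G : SimpleGraph (Fin n)), EnumeratesOn P prog G (trace G)
  length_lt : ∀ {n : ℕ} (G : SimpleGraph (Fin n)),
    (trace G).length < (n + (maxConnectedPSets P G).ncard + 2) ^ deg

theorem SolvableInPolyTotalTime.nonempty_enumerator {P : GraphClass}
    (h : SolvableInPolyTotalTime P) : Nonempty (Enumerator P) := by
  obtain ⟨c, p, h⟩ := h
  obtain ⟨d, hd⟩ := p.exists_eval_lt_pow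
  choose tr htr hlen using h
  exact ⟨⟨c, d, fun {n} G => tr n G, fun {n} G => htr n G,
    fun {n} G => (hlen n G).trans_lt (hd _ _)⟩⟩

namespace Enumerator

variable {P : GraphClass} (A : Enumerator P) {n : ℕ} (G : SimpleGraph (Fin n)) (B : ℕ)
  (L : List (Finset (Fin n))) {K K' U X : Finset (Fin n)} {v : Fin n}

/-- The solutions output in the first `B` steps. -/
noncomputable def found : List (Finset (Fin n)) :=
  (A.enumerates G).exists_list.choose.take (Trace.outputs ((A.trace G).take B)).length

theorem map_found : (A.found G B).map encodeVertexSet =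
    Trace.outputs ((A.trace G).take B) := by
  obtain ⟨-, -, h, -⟩ := (A.enumerates G).exists_list.choose_spec
  rw [found, List.map_take, ← h]
  exact (List.prefix_iff_eq_take.1 (Trace.outputs_take_prefix _ _)).symm

variable {A G B L}

theorem mem_maxConnectedPSets_of_mem_found (h : U ∈ A.found G B) : U ∈ maxConnectedPSets P G := by
  obtain ⟨-, h', -, -⟩ := (A.enumerates G).exists_list.choose_spec
  exact (h' U).1 (List.mem_of_mem_take h)

theorem mem_found (hB : (A.trace G).length < B) (h : U ∈ maxConnectedPSets P G) :
    U ∈ A.found G B := by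
  obtain ⟨-, h', h'', -⟩ := (A.enumerates G).exists_list.choose_spec
  rw [found, List.take_of_length_le hB.le, List.take_of_length_le
    ((List.length_map _).symm.trans (congrArg List.length h'').symm).le]
  exact (h' U).2 h

variable (A G B L)

/-- The test for an uncovered set in `K`: either one is found in the first `B` steps, or the
program does not halt in these. -/
def Uncovers (K : Finset (Fin n)) : Prop :=
  (∃ W ∈ A.found (restrict G K) B, ∀ U ∈ L, ¬ W.map (vertexEmb K) ⊆ U) ∨
    ¬ (A.trace (restrict G K)).length < B

/-- The test for `K` being a connected `P` set. -/
def Accepts (K : Finset (Fin n)) : Prop :=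
  ∃ W ∈ A.found (restrict G K) B, K ⊆ W.map (vertexEmb K)

open Classical in
/-- Vertices are removed from `K` as long as some uncovered set remains. -/
noncomputable def shrink (K : Finset (Fin n)) : Finset (Fin n) :=
  (List.finRange n).foldl
    (fun K u => if A.Uncovers G B L (K.erase u) then K.erase u else K) K

open Classical in
/-- Vertices are added to `K` as long as it remains a connected `P` set. -/
noncomputable def grow (K : Finset (Fin n)) : Finset (Fin n) :=
  (List.finRange n).foldl (fun K u => if A.Accepts G B (insert u K) then insert u K else K) K

/-- A maximal connected `P` set that contains `K`. -/
noncomputable def extend (K : Finset (Fin n)) : Finset (Fin n) := (A.grow G B)^[n] K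

open Classical in
/-- A solution that is not in `L`, if there is one. -/
noncomputable def next : Option (Finset (Fin n)) :=
  L.findSome? fun U => (List.finRange n).findSome? fun v =>
    if A.Uncovers G B L (insert v U) then some (A.extend G B (A.shrink G B L (insert v U)))
    else none

variable {A G B L}

/-- A timeout shows that `G[K]` has more than `|L| + n` solutions, hence an uncovered set. If the
run halts in time, all solutions of `G[K]` are found, and an uncovered set lies in one of them,
which is then uncovered too. -/
theorem uncovers_iff (hP : P.Hereditary) (hL : ∀ U ∈ L, U = ∅ ∨ IsConnectedPSet P G U)
    (hB : (n + n + L.length + 2) ^ A.deg ≤ B) (hU : U ∈ L) (hK : K ⊆ insert v U) :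
    A.Uncovers G B L K ↔ HasUncovered P G L K := by
  constructor
  · rintro (⟨W, hW, h⟩ | h)
    · exact ⟨_, isConnectedPSet_restrict.1 (mem_maxConnectedPSets_of_mem_found hW).prop,
        map_vertexEmb_subset W, h⟩
    · by_contra hcon
      refine h ((A.length_lt _).trans_le (le_trans (Nat.pow_le_pow_left ?_ _) hB))
      have := ncard_maxConnectedPSets_restrict_le hP hL hU hK hcon
      have := length_vertexList_le K
      omega
  · rintro ⟨X, hX, hXK, hXL⟩
    by_cases hlt : (A.trace (restrict G K)).length < B
    · obtain ⟨W, hW, hXW⟩ := exists_mem_maxConnectedPSets_restrict hX hXK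
      exact .inl ⟨W, mem_found hlt hW, fun U hU hWU => hXL U hU (hXW.trans hWU)⟩
    · exact .inr hlt

/-- If `K` is a connected `P` set, it is the only solution of `G[K]`, so the program halts within
the time for `n` vertices and one solution. -/
theorem accepts_iff (hB : (n + 3) ^ A.deg ≤ B) : A.Accepts G B K ↔ IsConnectedPSet P G K := by
  constructor
  · rintro ⟨W, hW, h⟩
    have h' := isConnectedPSet_restrict.1 (mem_maxConnectedPSets_of_mem_found hW).prop
    rwa [(map_vertexEmb_subset W).antisymm h] at h'
  · intro h
    have huniv : maxConnectedPSets P (restrict G K) = {Finset.univ} := by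
      have h' : IsConnectedPSet P (restrict G K) Finset.univ := by
        rwa [isConnectedPSet_restrict, map_univ_vertexEmb]
      ext W
      constructor
      · intro hW
        exact eq_of_mem_maxConnectedPSets hW h' (Finset.subset_univ W)
      · rintro rfl
        exact ⟨h', fun _ _ _ => Finset.subset_univ _⟩
    refine ⟨Finset.univ, mem_found ?_ (by rw [huniv]; rfl), (map_univ_vertexEmb K).ge⟩
    refine (A.length_lt _).trans_le (le_trans (Nat.pow_le_pow_left ?_ _) hB)
    rw [huniv, Set.ncard_singleton]
    have := length_vertexList_le K
    omega

/-- One pass suffices because `HasUncovered` is monotone: a vertex that could not be erased cannot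
be erased later from a smaller set. At the end no vertex can be spared, so the uncovered set that
remains inside is the whole set. -/
theorem shrink_spec (hP : P.Hereditary) (hL : ∀ U ∈ L, U = ∅ ∨ IsConnectedPSet P G U)
    (hB : (n + n + L.length + 2) ^ A.deg ≤ B) (hU : U ∈ L)
    (h : HasUncovered P G L (insert v U)) :
    IsConnectedPSet P G (A.shrink G B L (insert v U)) ∧
      ∀ U' ∈ L, ¬ A.shrink G B L (insert v U) ⊆ U' := by
  classical
  have key : ∀ (l : List (Fin n)) (K : Finset (Fin n)), HasUncovered P G L K → K ⊆ insert v U →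
      ∃ K', l.foldl (fun K u => if A.Uncovers G B L (K.erase u) then K.erase u else K) K = K' ∧
        K' ⊆ K ∧ HasUncovered P G L K' ∧
        ∀ u ∈ l, u ∈ K' → ¬ HasUncovered P G L (K'.erase u) := by
    intro l
    induction l with
    | nil => intro K hK hKU; exact ⟨K, rfl, Finset.Subset.refl K, hK, by simp⟩
    | cons u l ih =>
      intro K hK hKU
      have hiff := uncovers_iff hP hL hB hU ((Finset.erase_subset u K).trans hKU)
      simp only [List.foldl_cons]
      split_ifs with hu
      · obtain ⟨K', h₁, h₂, h₃, h₄⟩ := ih (K.erase u) (hiff.1 hu)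
          ((Finset.erase_subset u K).trans hKU)
        refine ⟨K', h₁, h₂.trans (Finset.erase_subset u K), h₃, fun w hw hwK => ?_⟩
        rcases List.mem_cons.1 hw with rfl | hw
        · exact absurd (h₂ hwK) (Finset.notMem_erase _ _)
        · exact h₄ w hw hwK
      · obtain ⟨K', h₁, h₂, h₃, h₄⟩ := ih K hK hKU
        refine ⟨K', h₁, h₂, h₃, fun w hw hwK => ?_⟩
        rcases List.mem_cons.1 hw with rfl | hw
        · exact fun hcon => hu (hiff.2 (hcon.mono (Finset.erase_subset_erase w h₂)))
        · exact h₄ w hw hwK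
  obtain ⟨K, h₁, -, ⟨X, hX, hXK, hXL⟩, h₄⟩ := key (List.finRange n) _ h (Finset.Subset.refl _)
  rw [shrink, h₁]
  have : X = K := by
    refine hXK.antisymm fun u hu => ?_
    by_contra huX
    exact h₄ u (List.mem_finRange u) hu ⟨X, hX, Finset.subset_erase.2 ⟨hXK, huX⟩, hXL⟩
  rw [← this]
  exact ⟨hX, hXL⟩

/-- One pass need not reach a maximal set, since a rejected vertex may become attachable after later
additions. Only a pass without change certifies that no vertex can be added. -/
theorem grow_spec (hB : (n + 3) ^ A.deg ≤ B) (hK : IsConnectedPSet P G K) :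
    IsConnectedPSet P G (A.grow G B K) ∧ K ⊆ A.grow G B K ∧
      (A.grow G B K = K → ∀ u, IsConnectedPSet P G (insert u K) → u ∈ K) := by
  classical
  have key : ∀ (l : List (Fin n)) (K : Finset (Fin n)), IsConnectedPSet P G K →
      ∃ K', l.foldl (fun K u => if A.Accepts G B (insert u K) then insert u K else K) K = K' ∧
        IsConnectedPSet P G K' ∧ K ⊆ K' ∧
        (K' = K → ∀ u ∈ l, IsConnectedPSet P G (insert u K) → u ∈ K) := by
    intro l
    induction l with
    | nil => intro K hK; exact ⟨K, rfl, hK, Finset.Subset.refl K, by simp⟩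
    | cons u l ih =>
      intro K hK
      simp only [List.foldl_cons, accepts_iff hB]
      split_ifs with hu
      · obtain ⟨K', h₁, h₂, h₃, h₄⟩ := ih _ hu
        simp only [accepts_iff hB] at h₁
        refine ⟨K', h₁, h₂, (Finset.subset_insert u K).trans h₃, fun heq => ?_⟩
        have huK : insert u K = K :=
          (heq ▸ h₃).antisymm (Finset.subset_insert u K)
        rw [huK] at h₄
        intro w hw hwK
        rcases List.mem_cons.1 hw with rfl | hw
        · exact Finset.insert_eq_self.1 huK
        · exact h₄ heq w hw hwK
      · obtain ⟨K', h₁, h₂, h₃, h₄⟩ := ih K hK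
        simp only [accepts_iff hB] at h₁
        refine ⟨K', h₁, h₂, h₃, fun heq w hw hwK => ?_⟩
        rcases List.mem_cons.1 hw with rfl | hw
        · exact absurd hwK hu
        · exact h₄ heq w hw hwK
  obtain ⟨K', h₁, h₂, h₃, h₄⟩ := key (List.finRange n) K hK
  rw [grow, h₁]
  exact ⟨h₂, h₃, fun h u => h₄ h u (List.mem_finRange u)⟩

/-- Each pass adds a vertex or has reached a set without one-vertex extension, which is maximal by
`exists_insert`. After `n` passes the first alternative would give more than `n` vertices. -/
theorem extend_spec (hP : P.Hereditary) (hB : (n + 3) ^ A.deg ≤ B)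
    (hK : IsConnectedPSet P G K) :
    A.extend G B K ∈ maxConnectedPSets P G ∧ K ⊆ A.extend G B K := by
  have key : ∀ k, IsConnectedPSet P G ((A.grow G B)^[k] K) ∧ K ⊆ (A.grow G B)^[k] K ∧
      (k < ((A.grow G B)^[k] K).card ∨ (A.grow G B)^[k] K ∈ maxConnectedPSets P G) := by
    intro k
    induction k with
    | zero => exact ⟨hK, Finset.Subset.refl K, .inl (Finset.card_pos.2 hK.nonempty)⟩
    | succ k ih =>
      obtain ⟨h₁, h₂, h₃⟩ := ih
      obtain ⟨g₁, g₂, g₃⟩ := grow_spec hB h₁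
      rw [Function.iterate_succ_apply']
      refine ⟨g₁, h₂.trans g₂, ?_⟩
      rcases h₃ with h₃ | h₃
      · by_cases heq : A.grow G B ((A.grow G B)^[k] K) = (A.grow G B)^[k] K
        · right
          rw [heq]
          refine ⟨h₁, fun T hT hle => ?_⟩
          by_contra hcon
          obtain ⟨u, -, hu, huK⟩ := hT.exists_insert hP h₁ ⟨hle, hcon⟩
          exact hu (g₃ heq u huK)
        · left
          have := Finset.card_lt_card (g₂.ssubset_of_ne (Ne.symm heq))
          omega
      · right
        rwa [← eq_of_mem_maxConnectedPSets h₃ g₁ g₂]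
  obtain ⟨-, h₂, h₃⟩ := key n
  refine ⟨h₃.resolve_left ?_, h₂⟩
  have := Finset.card_le_univ ((A.grow G B)^[n] K)
  rw [Fintype.card_fin] at this
  omega

theorem next_eq_some (hP : P.Hereditary) (hL : ∀ U ∈ L, U = ∅ ∨ IsConnectedPSet P G U)
    (hB : (n + n + L.length + 2) ^ A.deg ≤ B) (h : A.next G B L = some U) :
    U ∈ maxConnectedPSets P G ∧ U ∉ L := by
  rw [next] at h
  obtain ⟨U', hU', h⟩ := List.exists_of_findSome?_eq_some h
  obtain ⟨v, -, h⟩ := List.exists_of_findSome?_eq_some h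
  split_ifs at h with hv
  obtain rfl := Option.some_injective _ h
  rw [uncovers_iff hP hL hB hU' (Finset.Subset.refl _)] at hv
  obtain ⟨h₁, h₂⟩ := shrink_spec hP hL hB hU' hv
  -- `L` is nonempty, so `n + 3 ≤ n + n + L.length + 2`.
  have hB' : (n + 3) ^ A.deg ≤ B := by
    refine (Nat.pow_le_pow_left ?_ _).trans hB
    have := List.length_pos_of_mem hU'
    omega
  obtain ⟨h₃, h₄⟩ := extend_spec hP hB' h₁
  -- If the extension were in `L`, it would cover the set found by `shrink`.
  exact ⟨h₃, fun hmem => h₂ _ hmem h₄⟩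

theorem mem_of_next_eq_none (hP : P.Hereditary) (hL : ∀ U ∈ L, U = ∅ ∨ IsConnectedPSet P G U)
    (hL₀ : ∅ ∈ L) (hB : (n + n + L.length + 2) ^ A.deg ≤ B) (h : A.next G B L = none)
    (hU : U ∈ maxConnectedPSets P G) : U ∈ L := by
  refine mem_of_forall_not_hasUncovered hP hL hL₀ (fun U hU v hcon => ?_) hU
  rw [next, List.findSome?_eq_none_iff] at h
  have h := List.findSome?_eq_none_iff.1 (h U hU) v (List.mem_finRange v)
  rw [if_pos ((uncovers_iff hP hL hB hU (Finset.Subset.refl _)).2 hcon)] at h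
  simp at h

end Enumerator

/-! ### The enumeration step in polynomial time -/

namespace PolyTime

variable {α : Type} {m : α → ℕ} {i o : α → BTree} {β : α → Type}

/-- The context may be extended by an element of a list. -/
theorem lift {e : (Σ a, β a) → BTree} (h : PolyTime m i o) :
    PolyTime (fun p : Σ a, β a => m p.1) (fun p => .cons (e p) (i p.1)) (fun p => o p.1) :=
  (PolyTime.id _ _).snd.comp (h.reindex (β := Σ a, β a) Sigma.fst)

/-- The context may be extended by elements of two nested lists. -/
theorem lift₂ {γ : (Σ a, β a) → Type} {e₁ e₂ : (Σ p, γ p) → BTree} (h : PolyTime m i o) :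
    PolyTime (fun q : Σ p : Σ a, β a, γ p => m q.1.1)
      (fun q => .cons (e₂ q) (.cons (e₁ q) (i q.1.1))) (fun q => o q.1.1) :=
  (PolyTime.id _ _).snd.snd.comp (h.reindex fun q : Σ p : Σ a, β a, γ p => q.1.1)

variable {n B : α → ℕ} {G : ∀ a, SimpleGraph (Fin (n a))} {K U : ∀ a, Finset (Fin (n a))}
  {v : ∀ a, Fin (n a)} {L : ∀ a, List (Finset (Fin (n a)))}

/-- Values listed along all vertices are thinned out to those of `K`, in the order of `vertexList`.
Applied to rows and then to columns, this yields the matrix of `restrict`. -/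
theorem filter_vertexSet (f : ∀ a, Fin (n a) → BTree) (hn : PolyBdd m n)
    (hK : PolyTime m i fun a => encodeVertexSet (K a))
    (hf : PolyTime m i fun a => .ofList ((List.finRange (n a)).map (f a))) :
    PolyTime m i fun a => .ofList ((vertexList (K a)).map (f a)) := by
  classical
  refine (filterMap (fun a => List.finRange (n a)) (fun a x => .cons (.bit (x ∈ K a)) (f a x))
    (fun a x => x ∈ K a) f (by simpa using hn)
    (zip _ _ f (by simpa using hn) (hK.congr fun a => encodeVertexSet_eq _) hf)
    (PolyTime.id _ _).fst.fst (PolyTime.id _ _).fst.snd).congr fun a => ?_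
  simp only [vertexList]
  congr!

theorem encodeGraph_restrict (hn : PolyBdd m n) (hG : PolyTime m i fun a => encodeGraph (G a))
    (hK : PolyTime m i fun a => encodeVertexSet (K a)) :
    PolyTime m i fun a => encodeGraph (restrict (G a) (K a)) := by
  have hn' : PolyBdd m fun a => (vertexList (K a)).length :=
    hn.mono fun a => length_vertexList_le _
  refine (map (fun a => vertexList (K a))
    (fun a x => .ofList ((List.finRange (n a)).map fun y => .bit ((G a).Adj x y)))
    (fun a x => .ofList ((vertexList (K a)).map fun y => .bit ((G a).Adj x y))) hn'
    (filter_vertexSet _ hn hK (hG.congr fun a => encodeGraph_eq _))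
    (filter_vertexSet _ (hn.reindex _) hK.lift (PolyTime.id _ _).fst)).congr fun a => ?_
  rw [encodeGraph]
  congr 1
  refine List.ext_getElem (by simp) fun j h₁ h₂ => ?_
  simp only [List.getElem_map, List.getElem_ofFn]
  congr 1
  exact List.ext_getElem (by simp) fun k h₃ h₄ => by simp [restrict, vertexEmb]

theorem bit_map_vertexEmb_subset {W : ∀ a, Finset (Fin (vertexList (K a)).length)}
    (hn : PolyBdd m n) (hK : PolyTime m i fun a => encodeVertexSet (K a))
    (hU : PolyTime m i fun a => encodeVertexSet (U a))
    (hW : PolyTime m i fun a => encodeVertexSet (W a)) :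
    PolyTime m i fun a => .bit ((W a).map (vertexEmb (K a)) ⊆ U a) := by
  classical
  have hn' : PolyBdd m fun a => (vertexList (K a)).length :=
    hn.mono fun a => length_vertexList_le _
  -- `W` is indexed by positions in `vertexList (K a)`, so `U` is first read at these positions and
  -- then compared bit by bit.
  have hU' : PolyTime m i fun a => .ofList ((List.finRange (vertexList (K a)).length).map
      fun x => .bit (vertexEmb (K a) x ∈ U a)) := by
    refine (filter_vertexSet _ hn hK (hU.congr fun a => encodeVertexSet_eq _)).congr fun a => ?_
    congr 1
    exact List.ext_getElem (by simp) fun k h₁ h₂ => by simp [vertexEmb]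
  refine (all (fun a => List.finRange (vertexList (K a)).length)
    (fun a x => .cons (.bit (x ∈ W a)) (.bit (vertexEmb (K a) x ∈ U a)))
    (fun a x => ¬ x ∈ W a ∨ vertexEmb (K a) x ∈ U a) (by simpa using hn')
    (zip _ _ _ (by simpa using hn') (hW.congr fun a => encodeVertexSet_eq _) hU')
    ((PolyTime.id _ _).fst.fst.bit_not.bit_or (PolyTime.id _ _).fst.snd)).congr
    fun a => BTree.bit_congr ?_
  simp only [Finset.subset_iff, Finset.mem_map, List.mem_finRange, true_imp_iff]
  constructor
  · rintro h _ ⟨x, hx, rfl⟩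
    exact (h x).resolve_left (not_not.2 hx)
  · exact fun h x => not_or_of_imp fun hx => h ⟨x, hx, rfl⟩

theorem encode_insert (hn : PolyBdd m n) (hK : PolyTime m i fun a => encodeVertexSet (K a))
    (hv : PolyTime m i fun a => encodeVertexSet {v a}) :
    PolyTime m i fun a => encodeVertexSet (insert (v a) (K a)) := by
  refine (map (fun a => List.finRange (n a))
    (fun a x => .cons (.bit (x ∈ ({v a} : Finset _))) (.bit (x ∈ K a)))
    (fun a x => .bit (x ∈ ({v a} : Finset _) ∨ x ∈ K a)) (by simpa using hn)
    (zip _ _ _ (by simpa using hn) (hv.congr fun a => encodeVertexSet_eq _)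
      (hK.congr fun a => encodeVertexSet_eq _))
    ((PolyTime.id _ _).fst.fst.bit_or (PolyTime.id _ _).fst.snd)).congr fun a => ?_
  simp only [encodeVertexSet_eq, Finset.mem_insert, Finset.mem_singleton]

theorem encode_erase (hn : PolyBdd m n) (hK : PolyTime m i fun a => encodeVertexSet (K a))
    (hv : PolyTime m i fun a => encodeVertexSet {v a}) :
    PolyTime m i fun a => encodeVertexSet ((K a).erase (v a)) := by
  refine (map (fun a => List.finRange (n a))
    (fun a x => .cons (.bit (x ∈ ({v a} : Finset _))) (.bit (x ∈ K a)))
    (fun a x => .bit (¬ x ∈ ({v a} : Finset _) ∧ x ∈ K a)) (by simpa using hn)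
    (zip _ _ _ (by simpa using hn) (hv.congr fun a => encodeVertexSet_eq _)
      (hK.congr fun a => encodeVertexSet_eq _))
    ((PolyTime.id _ _).fst.fst.bit_not.bit_and (PolyTime.id _ _).fst.snd)).congr fun a => ?_
  simp only [encodeVertexSet_eq, Finset.mem_erase, Finset.mem_singleton, ne_eq]

theorem encode_singletons (hn : PolyBdd m n) (h : PolyTime m i fun a => .unary (n a)) :
    PolyTime m i fun a => .ofList ((List.finRange (n a)).map fun v => encodeVertexSet {v}) :=
  (idMatrix hn h).congr fun a => by simp only [encodeVertexSet_eq, Finset.mem_singleton]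

end PolyTime

namespace Enumerator

variable {P : GraphClass} (A : Enumerator P) {α : Type} {m : α → ℕ} {i : α → BTree}
  {n B : α → ℕ} {G : ∀ a, SimpleGraph (Fin (n a))} {K : ∀ a, Finset (Fin (n a))}
  {L : ∀ a, List (Finset (Fin (n a)))}

/-- Each output takes a step; this bounds loops over the found solutions even when `G[K]` has far
more. -/
theorem length_found_le {n : ℕ} (G : SimpleGraph (Fin n)) (B : ℕ) :
    (A.found G B).length ≤ B := by
  have h := congrArg List.length (A.map_found G B)
  rw [List.length_map] at h
  rw [h]
  exact (List.reduceOption_length_le _).trans (by simp)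

theorem polyTime_run (hn : PolyBdd m n) (hB : PolyBdd m B)
    (hG : PolyTime m i fun a => encodeGraph (G a))
    (hK : PolyTime m i fun a => encodeVertexSet (K a)) (hB' : PolyTime m i fun a => .unary (B a)) :
    PolyTime m i fun a => .cons
      (.ofList ((A.found (restrict (G a) (K a)) (B a)).reverse.map encodeVertexSet))
      (.unary (B a - (A.trace (restrict (G a) (K a))).length)) :=
  (PolyTime.simulate A.prog (fun a => (A.enumerates (restrict (G a) (K a))).1) hB
    (PolyTime.encodeGraph_restrict hn hG hK) hB').congr fun a => by
      rw [List.map_reverse, map_found]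

theorem polyTime_uncovers (hn : PolyBdd m n) (hB : PolyBdd m B)
    (hLen : PolyBdd m fun a => (L a).length)
    (hG : PolyTime m i fun a => encodeGraph (G a)) (hB' : PolyTime m i fun a => .unary (B a))
    (hL : PolyTime m i fun a => .ofList ((L a).map encodeVertexSet))
    (hK : PolyTime m i fun a => encodeVertexSet (K a)) :
    PolyTime m i fun a => .bit (A.Uncovers (G a) (B a) (L a) (K a)) := by
  have hrun := A.polyTime_run hn hB hG hK hB'
  have hany := PolyTime.any (fun a => (A.found (restrict (G a) (K a)) (B a)).reverse)
    (fun _ => encodeVertexSet) (fun a W => ∀ U ∈ L a, ¬ W.map (vertexEmb (K a)) ⊆ U)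
    (hB.mono fun a => by simpa using A.length_found_le _ _) hrun.fst
    (PolyTime.all (fun p : Σ a, Finset (Fin (vertexList (K a)).length) => L p.1)
      (fun _ => encodeVertexSet) (fun p U => ¬ p.2.map (vertexEmb (K p.1)) ⊆ U) (hLen.reindex _) hL.lift
      (PolyTime.bit_map_vertexEmb_subset ((hn.reindex _).reindex _) hK.lift₂
        (PolyTime.id _ _).fst (PolyTime.id _ _).snd.fst).bit_not)
  -- The simulation shows halting only as time left on the clock, which is why `Uncovers` asks for a
  -- strict inequality.
  refine (hany.bit_or hrun.snd.bit_ne_nil.bit_not).congr fun a => BTree.bit_congr ?_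
  simp only [List.mem_reverse, ne_eq, BTree.unary_eq_nil, Nat.sub_eq_zero_iff_le, not_not, not_lt,
    Uncovers]

theorem polyTime_accepts (hn : PolyBdd m n) (hB : PolyBdd m B)
    (hG : PolyTime m i fun a => encodeGraph (G a)) (hB' : PolyTime m i fun a => .unary (B a))
    (hK : PolyTime m i fun a => encodeVertexSet (K a)) :
    PolyTime m i fun a => .bit (A.Accepts (G a) (B a) (K a)) := by
  have hrun := A.polyTime_run hn hB hG hK hB'
  have hn' : PolyBdd m fun a => (vertexList (K a)).length :=
    hn.mono fun a => length_vertexList_le _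
  refine (PolyTime.any (fun a => (A.found (restrict (G a) (K a)) (B a)).reverse)
    (fun _ => encodeVertexSet)
    (fun a W => ∀ x ∈ List.finRange (vertexList (K a)).length, x ∈ W)
    (hB.mono fun a => by simpa using A.length_found_le _ _) hrun.fst
    (PolyTime.all (fun p : Σ a, Finset (Fin (vertexList (K a)).length) =>
      List.finRange (vertexList (K p.1)).length) (fun p x => .bit (x ∈ p.2)) (fun p x => x ∈ p.2) (by simpa using hn'.reindex _)
      ((PolyTime.id _ _).fst.congr fun p => encodeVertexSet_eq _)
      (PolyTime.id _ _).fst)).congr fun a => BTree.bit_congr ?_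
  simp only [List.mem_reverse, List.mem_finRange, true_imp_iff, Accepts]
  refine exists_congr fun W => and_congr_right fun _ => ?_
  constructor
  · intro h
    rw [Finset.eq_univ_of_forall h, map_univ_vertexEmb]
  · exact fun h x => (Finset.mem_map' _).1 (h (map_vertexEmb_subset {x} (by simp)))

theorem polyTime_shrink (hn : PolyBdd m n) (hB : PolyBdd m B)
    (hLen : PolyBdd m fun a => (L a).length)
    (hI : PolyTime m i fun a => .ofList ((List.finRange (n a)).map fun v => encodeVertexSet {v}))
    (hG : PolyTime m i fun a => encodeGraph (G a)) (hB' : PolyTime m i fun a => .unary (B a))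
    (hL : PolyTime m i fun a => .ofList ((L a).map encodeVertexSet))
    (hK : PolyTime m i fun a => encodeVertexSet (K a)) :
    PolyTime m i fun a => encodeVertexSet (A.shrink (G a) (B a) (L a) (K a)) := by
  classical
  refine PolyTime.foldl (γ := fun a => Finset (Fin (n a))) (fun a => List.finRange (n a))
    (fun a v => encodeVertexSet {v}) (fun a => encodeVertexSet)
    (fun a K u => if A.Uncovers (G a) (B a) (L a) (K.erase u) then K.erase u else K) K
    (by simpa using hn) hI hK ?_
  have hn' := hn.reindex fun p : Σ a, Finset (Fin (n a)) × Fin (n a) => p.1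
  have hid := PolyTime.id (fun p : Σ a, Finset (Fin (n a)) × Fin (n a) => m p.1)
    (fun p => .cons (encodeVertexSet {p.2.2}) (.cons (encodeVertexSet p.2.1) (i p.1)))
  have her := PolyTime.encode_erase hn' hid.snd.fst hid.fst
  have hctx : ∀ {o : α → BTree}, PolyTime m i o →
      PolyTime (fun p : Σ a, Finset (Fin (n a)) × Fin (n a) => m p.1) _ fun p => o p.1 := fun h =>
    hid.snd.snd.comp (h.reindex fun p : Σ a, Finset (Fin (n a)) × Fin (n a) => p.1)
  exact ((A.polyTime_uncovers hn' (hB.reindex _) (hLen.reindex _) (hctx hG) (hctx hB') (hctx hL)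
    her).ite her hid.snd.fst).congr fun p => (apply_ite encodeVertexSet _ _ _).symm

theorem polyTime_grow (hn : PolyBdd m n) (hB : PolyBdd m B)
    (hI : PolyTime m i fun a => .ofList ((List.finRange (n a)).map fun v => encodeVertexSet {v}))
    (hG : PolyTime m i fun a => encodeGraph (G a)) (hB' : PolyTime m i fun a => .unary (B a))
    (hK : PolyTime m i fun a => encodeVertexSet (K a)) :
    PolyTime m i fun a => encodeVertexSet (A.grow (G a) (B a) (K a)) := by
  classical
  refine PolyTime.foldl (γ := fun a => Finset (Fin (n a))) (fun a => List.finRange (n a))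
    (fun a v => encodeVertexSet {v}) (fun a => encodeVertexSet)
    (fun a K u => if A.Accepts (G a) (B a) (insert u K) then insert u K else K) K
    (by simpa using hn) hI hK ?_
  have hn' := hn.reindex fun p : Σ a, Finset (Fin (n a)) × Fin (n a) => p.1
  have hid := PolyTime.id (fun p : Σ a, Finset (Fin (n a)) × Fin (n a) => m p.1)
    (fun p => .cons (encodeVertexSet {p.2.2}) (.cons (encodeVertexSet p.2.1) (i p.1)))
  have hins := PolyTime.encode_insert hn' hid.snd.fst hid.fst
  have hctx : ∀ {o : α → BTree}, PolyTime m i o →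
      PolyTime (fun p : Σ a, Finset (Fin (n a)) × Fin (n a) => m p.1) _ fun p => o p.1 := fun h =>
    hid.snd.snd.comp (h.reindex fun p : Σ a, Finset (Fin (n a)) × Fin (n a) => p.1)
  exact ((A.polyTime_accepts hn' (hB.reindex _) (hctx hG) (hctx hB')
    hins).ite hins hid.snd.fst).congr fun p => (apply_ite encodeVertexSet _ _ _).symm

theorem polyTime_extend (hn : PolyBdd m n) (hB : PolyBdd m B)
    (hI : PolyTime m i fun a => .ofList ((List.finRange (n a)).map fun v => encodeVertexSet {v}))
    (hG : PolyTime m i fun a => encodeGraph (G a)) (hB' : PolyTime m i fun a => .unary (B a))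
    (hK : PolyTime m i fun a => encodeVertexSet (K a)) :
    PolyTime m i fun a => encodeVertexSet (A.extend (G a) (B a) (K a)) := by
  -- A fold over the `n` vertices that ignores the vertex is the `n`-fold iteration.
  refine (PolyTime.foldl (γ := fun a => Finset (Fin (n a))) (fun a => List.finRange (n a))
    (fun a v => encodeVertexSet {v}) (fun a => encodeVertexSet)
    (fun a K _ => A.grow (G a) (B a) K) K (by simpa using hn) hI hK ?_).congr fun a => by
      rw [List.foldl_const, List.length_finRange]; rfl
  have hid := PolyTime.id (fun p : Σ a, Finset (Fin (n a)) × Fin (n a) => m p.1)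
    (fun p => .cons (encodeVertexSet {p.2.2}) (.cons (encodeVertexSet p.2.1) (i p.1)))
  have hctx : ∀ {o : α → BTree}, PolyTime m i o →
      PolyTime (fun p : Σ a, Finset (Fin (n a)) × Fin (n a) => m p.1) _ fun p => o p.1 := fun h =>
    hid.snd.snd.comp (h.reindex fun p : Σ a, Finset (Fin (n a)) × Fin (n a) => p.1)
  exact A.polyTime_grow (hn.reindex _) (hB.reindex _) (hctx hI) (hctx hG) (hctx hB') hid.snd.fst

theorem polyTime_next (hn : PolyBdd m n) (hB : PolyBdd m B)
    (hLen : PolyBdd m fun a => (L a).length)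
    (hI : PolyTime m i fun a => .ofList ((List.finRange (n a)).map fun v => encodeVertexSet {v}))
    (hG : PolyTime m i fun a => encodeGraph (G a)) (hB' : PolyTime m i fun a => .unary (B a))
    (hL : PolyTime m i fun a => .ofList ((L a).map encodeVertexSet)) :
    PolyTime m i fun a => .ofOption encodeVertexSet (A.next (G a) (B a) (L a)) := by
  classical
  refine PolyTime.findSome L (fun _ => encodeVertexSet) (fun _ => encodeVertexSet)
    (fun a U => (List.finRange (n a)).findSome? fun v =>
      if A.Uncovers (G a) (B a) (L a) (insert v U) then
        some (A.extend (G a) (B a) (A.shrink (G a) (B a) (L a) (insert v U))) else none)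
    hLen hL ?_
  refine PolyTime.findSome (fun p : Σ a, Finset (Fin (n a)) => List.finRange (n p.1))
    (fun _ v => encodeVertexSet {v}) (fun _ => encodeVertexSet)
    (fun p v => if A.Uncovers (G p.1) (B p.1) (L p.1) (insert v p.2) then
        some (A.extend (G p.1) (B p.1) (A.shrink (G p.1) (B p.1) (L p.1) (insert v p.2))) else none)
    (by simpa using hn.reindex _) hI.lift ?_
  have hn' := (hn.reindex (Sigma.fst (β := fun a => Finset (Fin (n a))))).reindex
    (Sigma.fst (β := fun p : Σ a, Finset (Fin (n a)) => Fin (n p.1)))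
  have hB₁ := (hB.reindex (Sigma.fst (β := fun a => Finset (Fin (n a))))).reindex
    (Sigma.fst (β := fun p : Σ a, Finset (Fin (n a)) => Fin (n p.1)))
  have hLen' := (hLen.reindex (Sigma.fst (β := fun a => Finset (Fin (n a))))).reindex
    (Sigma.fst (β := fun p : Σ a, Finset (Fin (n a)) => Fin (n p.1)))
  have hins := PolyTime.encode_insert hn' (PolyTime.id
    (fun q : Σ p : Σ a, Finset (Fin (n a)), Fin (n p.1) => m q.1.1)
    (fun q => .cons (encodeVertexSet {q.2}) (.cons (encodeVertexSet q.1.2) (i q.1.1)))).snd.fst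
    (PolyTime.id _ _).fst
  refine ((A.polyTime_uncovers hn' hB₁ hLen' hG.lift₂ hB'.lift₂ hL.lift₂ hins).ite
    ((A.polyTime_extend hn' hB₁ hI.lift₂ hG.lift₂ hB'.lift₂
      (A.polyTime_shrink hn' hB₁ hLen' hI.lift₂ hG.lift₂ hB'.lift₂ hL.lift₂
        hins)).cons PolyTime.nil) PolyTime.nil).congr fun p => ?_
  split_ifs <;> rfl

/-! ### The enumeration -/

/-- The number of steps that the program is run for. -/
def budget (n k : ℕ) : ℕ := (k + (n + n) + 2) ^ A.deg

/-- The first solutions, and the empty set. -/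
noncomputable def solutionList {n : ℕ} (G : SimpleGraph (Fin n)) : ℕ → List (Finset (Fin n))
  | 0 => [∅]
  | j + 1 => (A.next G (A.budget n (solutionList G j).length) (solutionList G j)).toList ++
      solutionList G j

/-- The next solution after the first `j` ones. -/
noncomputable def nextSolution {n : ℕ} (G : SimpleGraph (Fin n)) (j : ℕ) :
    Option (Finset (Fin n)) :=
  A.next G (A.budget n (A.solutionList G j).length) (A.solutionList G j)

theorem solutionList_succ {n : ℕ} (G : SimpleGraph (Fin n)) (j : ℕ) :
    A.solutionList G (j + 1) = (A.nextSolution G j).toList ++ A.solutionList G j := rfl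

theorem length_solutionList_le {n : ℕ} (G : SimpleGraph (Fin n)) (j : ℕ) :
    (A.solutionList G j).length ≤ j + 1 := by
  induction j with
  | zero => simp [solutionList]
  | succ j ih =>
    rw [solutionList_succ, List.length_append]
    have : (A.nextSolution G j).toList.length ≤ 1 := by cases A.nextSolution G j <;> simp
    omega

/-- What is known when the solution with index `j` is found: the solution, the graph, and the list
of the solutions so far. -/
noncomputable def state {n : ℕ} (G : SimpleGraph (Fin n)) (j : ℕ) : BTree :=
  (A.nextSolution G j).elim .nil fun U => .cons (encodeVertexSet U)
    (.cons (encodeGraph G) (.ofList ((A.solutionList G (j + 1)).map encodeVertexSet)))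

/-- The list has at most `j + 1` members, so the budget, and with it the whole step, is polynomial
in `n + j`; this makes the enumeration incremental. -/
theorem polyTime_state : PolyTime (fun p : (Σ n, SimpleGraph (Fin n)) × ℕ => p.1.1 + p.2)
    (fun p => .cons (encodeGraph p.1.2) (.ofList ((A.solutionList p.1.2 p.2).map encodeVertexSet)))
    (fun p => A.state p.1.2 p.2) := by
  have hid := PolyTime.id (fun p : (Σ n, SimpleGraph (Fin n)) × ℕ => p.1.1 + p.2)
    (fun p => .cons (encodeGraph p.1.2) (.ofList ((A.solutionList p.1.2 p.2).map encodeVertexSet)))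
  have hn : PolyBdd (fun p : (Σ n, SimpleGraph (Fin n)) × ℕ => p.1.1 + p.2) (fun p => p.1.1) :=
    (PolyBdd.self _).mono fun p => by simp
  have hLen : PolyBdd (fun p : (Σ n, SimpleGraph (Fin n)) × ℕ => p.1.1 + p.2)
      (fun p => (A.solutionList p.1.2 p.2).length) :=
    ((PolyBdd.self _).add (PolyBdd.const _ 1)).mono fun p =>
      (A.length_solutionList_le p.1.2 p.2).trans (by omega)
  have hun := (PolyTime.unary_length _ (by simpa using hn) hid.fst).congr
    (f := fun p => .unary p.1.1) fun p => by simp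
  have hB : PolyBdd (fun p : (Σ n, SimpleGraph (Fin n)) × ℕ => p.1.1 + p.2)
      (fun p => A.budget p.1.1 (A.solutionList p.1.2 p.2).length) :=
    ((hLen.add (hn.add hn)).add (PolyBdd.const _ 2)).pow A.deg
  have hB' : PolyTime _ _ fun p : (Σ n, SimpleGraph (Fin n)) × ℕ =>
      .unary (A.budget p.1.1 (A.solutionList p.1.2 p.2).length) :=
    PolyTime.unary_pow ((hLen.add (hn.add hn)).add (PolyBdd.const _ 2))
      (PolyTime.unary_add (PolyBdd.const _ 2) (PolyTime.unary_const 2)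
        (PolyTime.unary_add (hn.add hn) (PolyTime.unary_add hn hun hun)
          ((PolyTime.unary_length _ (by simpa using hLen) hid.snd).congr fun p => by simp)))
      A.deg
  have hnext := A.polyTime_next hn hB hLen (PolyTime.encode_singletons hn hun) hid.fst hB' hid.snd
  refine hnext.cases (((hnext.hd.cons (hid.fst.cons (hnext.hd.cons hid.snd))).reindex
    Subtype.val).congr ?_) (PolyTime.nil.congr ?_)
  · rintro ⟨p, hp⟩
    change _ = A.state p.1.2 p.2
    rw [state, solutionList_succ, nextSolution]
    cases h : A.next p.1.2 (A.budget p.1.1 (A.solutionList p.1.2 p.2).length)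
      (A.solutionList p.1.2 p.2)
    · simp [h, BTree.ofOption] at hp
    · simp [BTree.ofOption]
  · rintro ⟨p, hp⟩
    change _ = A.state p.1.2 p.2
    rw [state, nextSolution]
    cases h : A.next p.1.2 (A.budget p.1.1 (A.solutionList p.1.2 p.2).length)
      (A.solutionList p.1.2 p.2)
    · simp
    · simp [h, BTree.ofOption] at hp

/-! ### Correctness of the sequence of solutions -/

section Correct

variable {n : ℕ} (G : SimpleGraph (Fin n))

theorem budget_ge (n k : ℕ) : (n + n + k + 2) ^ A.deg ≤ A.budget n k :=
  (congrArg (fun x => (x + 2) ^ A.deg) (add_comm _ _)).le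

variable {A G} in
theorem good_of_solutionList_eq {j : ℕ} {l : List (Finset (Fin n))}
    (hl : A.solutionList G j = l ++ [∅]) (hmem : ∀ U ∈ l, U ∈ maxConnectedPSets P G) :
    ∀ U ∈ A.solutionList G j, U = ∅ ∨ IsConnectedPSet P G U := by
  intro U hU
  rw [hl, List.mem_append, List.mem_singleton] at hU
  exact hU.symm.imp id fun h => (hmem U h).prop

/-- If the search failed after `j < N` solutions, the list would already contain all `N` of them.
New solutions are put in front, hence the reversed order and `∅` at the end. -/
theorem exists_solutionList_eq (hP : P.Hereditary) {j : ℕ} (hj : j ≤ (maxConnectedPSets P G).ncard) :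
    ∃ l : List (Finset (Fin n)), A.solutionList G j = l ++ [∅] ∧ l.Nodup ∧ l.length = j ∧
      (∀ U ∈ l, U ∈ maxConnectedPSets P G) ∧
      (List.range j).map (fun k => (A.nextSolution G k).elim .nil encodeVertexSet) =
        (l.map encodeVertexSet).reverse := by
  induction j with
  | zero => exact ⟨[], rfl, by simp, rfl, by simp, by simp⟩
  | succ j ih =>
    obtain ⟨l, hl, hnd, hlen, hmem, hmap⟩ := ih (by omega)
    have hgood := good_of_solutionList_eq hl hmem
    have hB := A.budget_ge n (A.solutionList G j).length
    rcases hnext : A.nextSolution G j with _ | U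
    · exfalso
      have hsub : maxConnectedPSets P G ⊆ (l.toFinset : Set (Finset (Fin n))) := by
        intro T hT
        have h := mem_of_next_eq_none hP hgood (by simp [hl]) hB hnext hT
        rw [hl, List.mem_append, List.mem_singleton] at h
        rcases h with h | rfl
        · simpa using h
        · exact absurd hT.prop.nonempty (by simp)
      have h := Set.ncard_le_ncard hsub (Finset.finite_toSet _)
      rw [Set.ncard_coe_finset] at h
      have := List.toFinset_card_le l
      omega
    · obtain ⟨hU, hUl⟩ := next_eq_some hP hgood hB hnext
      refine ⟨U :: l, ?_, ?_, by simp [hlen], ?_, ?_⟩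
      · rw [solutionList_succ, hnext, hl]; rfl
      · exact List.nodup_cons.2 ⟨fun h => hUl (by simp [hl, h]), hnd⟩
      · exact List.forall_mem_cons.2 ⟨hU, hmem⟩
      · rw [List.range_succ, List.map_append, hmap]
        simp [hnext]

theorem nextSolution_ne_none (hP : P.Hereditary) {j : ℕ}
    (hj : j < (maxConnectedPSets P G).ncard) : A.nextSolution G j ≠ none := by
  obtain ⟨l, hl, -, hlen, -⟩ := A.exists_solutionList_eq G hP hj.le
  obtain ⟨l', hl', -, hlen', -⟩ := A.exists_solutionList_eq G hP (j := j + 1) hj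
  intro h
  rw [solutionList_succ, h, hl] at hl'
  have := congrArg List.length hl'
  simp at this
  omega

theorem nextSolution_ncard (hP : P.Hereditary) :
    A.nextSolution G (maxConnectedPSets P G).ncard = none ∧
      ∃ l : List (Finset (Fin n)), l.Nodup ∧ (∀ U, U ∈ l ↔ U ∈ maxConnectedPSets P G) ∧
        (List.range (maxConnectedPSets P G).ncard).map
          (fun k => (A.nextSolution G k).elim .nil encodeVertexSet) =
            (l.map encodeVertexSet).reverse := by
  obtain ⟨l, hl, hnd, hlen, hmem, hmap⟩ := A.exists_solutionList_eq G hP le_rfl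
  have heq : (l.toFinset : Set (Finset (Fin n))) = maxConnectedPSets P G := by
    refine Set.eq_of_subset_of_ncard_le (fun U hU => hmem U (by simpa using hU)) ?_
      (Set.toFinite _)
    rw [Set.ncard_coe_finset, List.toFinset_card_of_nodup hnd, hlen]
  have hiff : ∀ U, U ∈ l ↔ U ∈ maxConnectedPSets P G := fun U => by rw [← heq]; simp
  refine ⟨?_, l, hnd, hiff, hmap⟩
  rcases hnext : A.nextSolution G (maxConnectedPSets P G).ncard with _ | U
  · rfl
  -- After `N` distinct solutions the list contains all of them, whereas a successful search would
  -- give another one.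
  · obtain ⟨hU, hUl⟩ := next_eq_some hP (good_of_solutionList_eq hl hmem) (A.budget_ge n _) hnext
    exact absurd (by rw [hl]; simp [(hiff U).2 hU]) hUl

end Correct

end Enumerator

/-! ### From polynomial total time to incremental polynomial time -/

theorem SolvableInPolyTotalTime.solvableInIncrementalPolyTime {P : GraphClass}
    (hP : P.Hereditary) (h : SolvableInPolyTotalTime P) : SolvableInIncrementalPolyTime P := by
  obtain ⟨A⟩ := h.nonempty_enumerator
  have hstart : PolyTime (fun a : Σ n, SimpleGraph (Fin n) => a.1) (fun a => encodeGraph a.2)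
      (fun a => A.state a.2 0) := by
    have hid := PolyTime.id (fun a : Σ n, SimpleGraph (Fin n) => a.1) (fun a => encodeGraph a.2)
    -- The characteristic vector of `∅` is a list of `n` copies of `nil`, that is, `n` in unary.
    have hun : PolyTime (fun a : Σ n, SimpleGraph (Fin n) => a.1) (fun a => encodeGraph a.2)
        fun a => encodeVertexSet (∅ : Finset (Fin a.1)) :=
      (PolyTime.unary_length _ (by simpa using PolyBdd.self _) hid).congr fun a => by
        simp [encodeVertexSet_eq, BTree.unary, List.map_const']
    exact (hid.cons (hun.cons PolyTime.nil)).comp (A.polyTime_state.reindex fun a => (a, 0))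
  obtain ⟨c, d, hc⟩ := PolyTime.exists_enumeration
    (N := fun a : Σ n, SimpleGraph (Fin n) => (maxConnectedPSets P a.2).ncard)
    (fun a j => A.state a.2 j)
    (fun a j => (A.nextSolution a.2 j).elim .nil encodeVertexSet)
    (fun a j => .cons (encodeGraph a.2)
      (.ofList ((A.solutionList a.2 (j + 1)).map encodeVertexSet)))
    (fun a j hj => by
      obtain ⟨U, hU⟩ := Option.ne_none_iff_exists'.1 (A.nextSolution_ne_none a.2 hP hj)
      simp [Enumerator.state, hU])
    (fun a => by simp [Enumerator.state, (A.nextSolution_ncard a.2 hP).1]) hstart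
    -- What remains of the state after output `j` is the input for finding the solution with index
    -- `j + 1`; the shift of the measure by one is absorbed.
    ((A.polyTime_state.reindex fun p : {p : (Σ n, SimpleGraph (Fin n)) × ℕ //
      p.2 < (maxConnectedPSets P p.1.2).ncard} => (p.1.1, p.1.2 + 1)).measure
      (((PolyBdd.self _).add (PolyBdd.const _ 1)).mono fun p => by simp [add_assoc]))
  refine ⟨c, (.X 0 + .X 1 + .C 2) ^ d, fun n G => ?_⟩
  obtain ⟨t, ht, ho, -, hs⟩ := hc ⟨n, G⟩
  obtain ⟨-, l, hnd, hl, hmap⟩ := A.nextSolution_ncard G hP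
  have hout : t.outputs = (l.map encodeVertexSet).reverse := ho.trans hmap
  refine ⟨t, ⟨ht, ?_, fun v => ?_⟩, fun s h₁ h₂ => by simpa using hs s h₁ h₂⟩
  · rw [hout]; exact List.nodup_reverse.2 (hnd.map encodeVertexSet_injective)
  · simp [hout, hl]

theorem mainTheorem3 (P : GraphClass) (hP : P.Hereditary) :
    SolvableInPolyTotalTime P ↔ SolvableInIncrementalPolyTime P :=
  ⟨fun h => h.solvableInIncrementalPolyTime hP, fun h => h.solvableInPolyTotalTime⟩
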